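/- Let $\mathcal{L}\subset\mathbb{R}^d$ be a lattice (a discrete additive subgroup) and let $P$ be a nonempty lattice polytope, i.e. the convex hull of finitely many points of $\mathcal{L}$, with an irredundant linear description $P=\{x\in\mathbb{R}^d : a_i^Tx\ge b_i,\ i=1,\dots,n\}$ (omitting any one of the inequalities changes the set). Given an ordered list $p_1,\dots,p_k$ of all the lattice points $P\cap\mathcal{L}$, the pulling triangulation $\Delta_{pull}(P)$ is defined recursively: if $p_1,\dots,p_k$ are affinely independent, $\Delta_{pull}(P)=\{\{p_1,\dots,p_k\}\}$; otherwise $\Delta_{pull}(P)=\bigcup_F\{\{p_1\}\cup\sigma : \sigma\in\Delta_{pull}(F)\}$, the union being over all facets $F$ of $P$ not containing $p_1$, with the induced ordering of the lattice points of $F$. A triangulation of $P$ is unimodular if each of its simplices attains the minimal $(\dim P)$-dimensional volume among all $(\dim P)$-dimensional simplices that are convex hulls of points of $P\cap\mathcal{L}$. The polytope $P$ is compressed if its pulling triangulation is unimodular for every ordering of $P\cap\mathcal{L}$. The following conditions are equivalent: 1. $P$ is compressed. 2. For each $i$ there is at most one nonzero real number $m_i$ such that the set $\{x\in\mathcal{L}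 : a_i^Tx=b_i+m_i\}\cap P$ is nonempty. 3. For some $N\ge 0$, $P$ is lattice isomorphic to an integral polytope of the form $C_N\cap L$, where $C_N=[0,1]^N$ is the unit hypercube and $L\subseteq\mathbb{R}^N$ is an affine subspace. That is, $C_N\cap L$ is the convex hull of finitely many points of $\mathbb{Z}^N$, and there is an affine map $\mathbb{R}^d\to\mathbb{R}^N$ that restricts to a bijection $P\to C_N\cap L$ and to a bijection $P\cap\mathcal{L}\to C_N\cap L\cap\mathbb{Z}^N$. Moreover, they are also equivalent to condition 3 with $N=n$, the number of inequalities. -/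

import Mathlib

/-- `F` is a facet of the polytope `P`: a nonempty (exposed) face of dimension `dim P - 1`. -/
def IsFacet {E : Type*} [NormedAddCommGroup E] [NormedSpace ℝ E] (P F : Set E) : Prop :=
  IsExposed ℝ P F ∧ F.Nonempty ∧
    Module.finrank ℝ (vectorSpan ℝ F) + 1 = Module.finrank ℝ (vectorSpan ℝ P)

/-- `P` is a lattice polytope for `Λ`: the convex hull of finitely many points of `Λ`. -/
def IsLatticePolytope {E : Type*} [NormedAddCommGroup E] [NormedSpace ℝ E]
    (Λ : Submodule ℤ E) (P : Set E) : Prop :=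
  ∃ s : Finset E, (s : Set E) ⊆ (Λ : Set E) ∧ P = convexHull ℝ (s : Set E)

open scoped Classical in
/-- `IsPullingSimplex P l σ`: the vertex set `σ` belongs to the pulling triangulation of the polytope
`P` induced by the ordered list `l` of its lattice points. If `l` is affinely independent, `σ` is
the set of all its points; otherwise `l = p :: t` and `σ = {p} ∪ τ` with `τ` in the pulling
triangulation of a facet `F` of `P` not containing `p`, for the induced order on the points in
`F`. -/
inductive IsPullingSimplex {E : Type*} [NormedAddCommGroup E] [NormedSpace ℝ E] :
    Set E → List E → Finset E → Prop
  | simplex (P : Set E) (l : List E)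
      (h : AffineIndependent ℝ (fun x : {x // x ∈ l} => (x : E))) :
      IsPullingSimplex P l l.toFinset
  | cone (P : Set E) (p : E) (t : List E) (F : Set E) (τ : Finset E)
      (h : ¬ AffineIndependent ℝ (fun x : {x // x ∈ p :: t} => (x : E)))
      (hF : IsFacet P F) (hp : p ∉ F)
      (hτ : IsPullingSimplex F ((p :: t).filter (fun x => x ∈ F)) τ) :
      IsPullingSimplex P (p :: t) (insert p τ)

/-- The pulling triangulation of the polytope `P` induced by the ordered list `l` of its lattice
points, given by the vertex sets of its maximal simplices. -/
def pullingTriangulation {E : Type*} [NormedAddCommGroup E] [NormedSpace ℝ E]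
    (P : Set E) (l : List E) : Set (Finset E) :=
  {σ | IsPullingSimplex P l σ}

/-- The vertex sets of the simplices of dimension `dim P` whose vertices are lattice points
of `P`. -/
def latticeSimplices {E : Type*} [NormedAddCommGroup E] [NormedSpace ℝ E]
    (Λ : Submodule ℤ E) (P : Set E) : Set (Finset E) :=
  {τ | (τ : Set E) ⊆ P ∩ Λ ∧ AffineIndependent ℝ (fun x : τ => (x : E)) ∧
    τ.card = Module.finrank ℝ (vectorSpan ℝ P) + 1}

/-- The `dim P`-dimensional volume (Hausdorff measure) of the convex hull of `τ`. -/
noncomputable def simplexVolume {d : ℕ} (P : Set (EuclideanSpace ℝ (Fin d)))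
    (τ : Finset (EuclideanSpace ℝ (Fin d))) : ENNReal :=
  MeasureTheory.Measure.euclideanHausdorffMeasure (Module.finrank ℝ (vectorSpan ℝ P))
    (convexHull ℝ (τ : Set (EuclideanSpace ℝ (Fin d))))

/-- A triangulation of `P` is unimodular if each of its simplices attains the minimal volume among
all (full-dimensional) simplices formed by lattice points of `P`. -/
def IsUnimodularTriangulation {d : ℕ} (Λ : Submodule ℤ (EuclideanSpace ℝ (Fin d)))
    (P : Set (EuclideanSpace ℝ (Fin d))) (Δ : Set (Finset (EuclideanSpace ℝ (Fin d)))) : Prop :=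
  ∀ σ ∈ Δ, IsLeast (simplexVolume P '' latticeSimplices Λ P) (simplexVolume P σ)

/-- `P` is compressed: for every ordering of its lattice points, the induced pulling triangulation
is unimodular. -/
def IsCompressed {d : ℕ} (Λ : Submodule ℤ (EuclideanSpace ℝ (Fin d)))
    (P : Set (EuclideanSpace ℝ (Fin d))) : Prop :=
  ∀ l : List (EuclideanSpace ℝ (Fin d)), l.Nodup → (∀ x, x ∈ l ↔ x ∈ P ∩ Λ) →
    IsUnimodularTriangulation Λ P (pullingTriangulation P l)

/-- Lattice isomorphism of `P` (with lattice `Λ`) and `Q` (with lattice `M`): an affine map that is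
a bijection from `P` to `Q` and from the lattice points of `P` to those of `Q`. -/
def LatticeIsomorphic {E E' : Type*} [NormedAddCommGroup E] [NormedSpace ℝ E]
    [NormedAddCommGroup E'] [NormedSpace ℝ E'] (Λ : Submodule ℤ E) (P : Set E)
    (M : Submodule ℤ E') (Q : Set E') : Prop :=
  ∃ f : E →ᵃ[ℝ] E', Set.BijOn f P Q ∧ Set.BijOn f (P ∩ Λ) (Q ∩ M)

/-- The lattice `ℤ^N` in `ℝ^N`. -/
def integerLattice (N : ℕ) : Submodule ℤ (EuclideanSpace ℝ (Fin N)) where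
  carrier := {x | ∀ i, ∃ k : ℤ, x i = k}
  zero_mem' := fun _ => ⟨0, by simp⟩
  add_mem' := fun {x y} hx hy i => by
    obtain ⟨k, hk⟩ := hx i
    obtain ⟨m, hm⟩ := hy i
    exact ⟨k + m, by simp [hk, hm]⟩
  smul_mem' := fun c x hx i => by
    obtain ⟨k, hk⟩ := hx i
    exact ⟨c * k, by simp [hk]⟩

/-- The unit hypercube `[0,1]^N`. -/
def unitCube (N : ℕ) : Set (EuclideanSpace ℝ (Fin N)) :=
  {x | ∀ i, 0 ≤ x i ∧ x i ≤ 1}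

/-- `P` is lattice isomorphic to an integral polytope of the form `C_N ∩ L`, with `C_N` the
`N`-dimensional unit hypercube and `L` an affine subspace. -/
def IsLatticeIsomorphicToCubeSection {d : ℕ} (Λ : Submodule ℤ (EuclideanSpace ℝ (Fin d)))
    (P : Set (EuclideanSpace ℝ (Fin d))) (N : ℕ) : Prop :=
  ∃ L : AffineSubspace ℝ (EuclideanSpace ℝ (Fin N)),
    IsLatticePolytope (integerLattice N) (unitCube N ∩ L) ∧
    LatticeIsomorphic Λ P (integerLattice N) (unitCube N ∩ L)

open Filter Topology

section Polyhedra

variable {E : Type*} [NormedAddCommGroup E] [NormedSpace ℝ E]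

theorem AffineMap.apply_add_smul (h : E →ᵃ[ℝ] ℝ) (x v : E) (t : ℝ) :
    h (x + t • v) = h x + t * h.linear v := by
  have := h.map_vadd x (t • v)
  simp only [vadd_eq_add, map_smul, smul_eq_mul] at this
  rw [add_comm x, this, add_comm]

theorem AffineMap.linear_sub_apply (h : E →ᵃ[ℝ] ℝ) (x y : E) :
    h.linear (x - y) = h x - h y := by
  simpa using h.linearMap_vsub x y

theorem AffineMap.apply_convexComb (h : E →ᵃ[ℝ] ℝ) (x y : E) {s t : ℝ} (hst : s + t = 1) :
    h (s • x + t • y) = s * h x + t * h y := by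
  simpa using Convex.combo_affine_apply (f := h) (x := x) (y := y) hst

/-- A polyhedron contains a small step from a point `x` in every direction along which the
inequalities that are tight at `x` do not decrease. -/
theorem exists_pos_add_smul_nonneg {T : Set (E →ᵃ[ℝ] ℝ)} (hT : T.Finite) {x v : E}
    (hx : ∀ h ∈ T, 0 ≤ h x) (hv : ∀ h ∈ T, h x = 0 → 0 ≤ h.linear v) :
    ∃ ε : ℝ, 0 < ε ∧ ∀ h ∈ T, 0 ≤ h (x + ε • v) := by
  have key : ∀ᶠ ε : ℝ in 𝓝[>] 0, ∀ h ∈ T, 0 ≤ h (x + ε • v) := by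
    rw [Filter.eventually_all_finite hT]
    intro h hh
    simp only [AffineMap.apply_add_smul]
    rcases (hx h hh).eq_or_lt with h0 | h0
    · filter_upwards [self_mem_nhdsWithin] with ε hε
      have := mul_nonneg (le_of_lt (Set.mem_Ioi.1 hε)) (hv h hh h0.symm)
      linarith
    · have : Tendsto (fun ε : ℝ => h x + ε * h.linear v) (𝓝[>] 0) (𝓝 (h x + 0 * h.linear v)) :=
        ((continuous_const.add (continuous_id.mul continuous_const)).tendsto 0).mono_left
          nhdsWithin_le_nhds
      rw [zero_mul, add_zero] at this
      exact (this.eventually (lt_mem_nhds h0)).mono fun _ h => h.le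
  obtain ⟨ε, h1, h2⟩ := (key.and self_mem_nhdsWithin).exists
  exact ⟨ε, h2, h1⟩

/-- A convex set on which finitely many affine functionals are nonnegative contains a point where
only those functionals vanish that vanish identically. -/
theorem exists_mem_forall_eq_zero_imp {S : Set E} (hS : Convex ℝ S) (hne : S.Nonempty)
    {T : Set (E →ᵃ[ℝ] ℝ)} (hT : T.Finite) (hpos : ∀ h ∈ T, ∀ x ∈ S, 0 ≤ h x) :
    ∃ y ∈ S, ∀ h ∈ T, h y = 0 → ∀ x ∈ S, h x = 0 := by
  induction T, hT using Set.Finite.induction_on with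
  | empty => obtain ⟨y, hy⟩ := hne; exact ⟨y, hy, by simp⟩
  | @insert h T _ _ ih =>
    obtain ⟨y, hy, hyT⟩ := ih fun g hg => hpos g (Set.mem_insert_of_mem _ hg)
    by_cases hz : ∀ x ∈ S, h x = 0
    · refine ⟨y, hy, fun g hg => ?_⟩
      rcases hg with rfl | hg
      · exact fun _ => hz
      · exact hyT g hg
    · push Not at hz
      obtain ⟨x, hx, hx0⟩ := hz
      refine ⟨(1 / 2 : ℝ) • y + (1 / 2 : ℝ) • x,
        hS hy hx (by norm_num) (by norm_num) (by norm_num), fun g hg h0 => ?_⟩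
      rw [AffineMap.apply_convexComb g y x (by norm_num)] at h0
      have h1 := hpos g hg y hy
      have h2 := hpos g hg x hx
      rcases hg with rfl | hg
      · exact absurd (by linarith) hx0
      · exact hyT g hg (by linarith)

theorem AffineMap.linear_eq_zero_of_mem_vectorSpan {h : E →ᵃ[ℝ] ℝ} {S : Set E}
    (hS : ∀ x ∈ S, h x = 0) {v : E} (hv : v ∈ vectorSpan ℝ S) : h.linear v = 0 := by
  have : vectorSpan ℝ S ≤ LinearMap.ker h.linear := by
    rw [vectorSpan_def, Submodule.span_le]
    rintro _ ⟨x, hx, y, hy, rfl⟩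
    simp [AffineMap.linear_sub_apply, hS x hx, hS y hy]
  exact this hv

theorem convex_forall_nonneg (T : Set (E →ᵃ[ℝ] ℝ)) : Convex ℝ {x | ∀ h ∈ T, 0 ≤ h x} := by
  intro u hu v hv s t hs ht hst g hg
  rw [AffineMap.apply_convexComb g u v hst]
  exact add_nonneg (mul_nonneg hs (hu g hg)) (mul_nonneg ht (hv g hg))

/-- An inequality that is irredundant and not an implied equality is tight at a point where all
other tight inequalities are implied equalities. -/
theorem exists_tight_of_irredundant {P : Set E} {T : Set (E →ᵃ[ℝ] ℝ)} (hT : T.Finite)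
    (hP : P = {x | ∀ h ∈ T, 0 ≤ h x}) {h : E →ᵃ[ℝ] ℝ} (hh : h ∈ T)
    {z : E} (hz : ∀ g ∈ T, g ≠ h → 0 ≤ g z) (hzh : h z < 0) {x : E} (hx : x ∈ P) (hxh : 0 < h x) :
    ∃ w ∈ P, h w = 0 ∧ ∀ g ∈ T, g ≠ h → g w = 0 → ∀ y ∈ P, g y = 0 := by
  have hconv : Convex ℝ P := hP ▸ convex_forall_nonneg T
  obtain ⟨y, hy, hyT⟩ := exists_mem_forall_eq_zero_imp hconv ⟨x, hx⟩ hT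
    (fun g hg u hu => by rw [hP] at hu; exact hu g hg)
  have hyP := hy
  rw [hP] at hyP
  have hhy : 0 < h y := (hyP h hh).lt_of_ne fun h0 => hxh.ne' (hyT h hh h0.symm x hx)
  have hd : 0 < h y - h z := by linarith
  have hs : 0 < -h z / (h y - h z) := div_pos (by linarith) hd
  have ht : 0 < h y / (h y - h z) := div_pos hhy hd
  have hst : -h z / (h y - h z) + h y / (h y - h z) = 1 := by field_simp; ring
  have hw : h ((-h z / (h y - h z)) • y + (h y / (h y - h z)) • z) = 0 := by
    rw [AffineMap.apply_convexComb h y z hst]; field_simp; ring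
  refine ⟨_, ?_, hw, fun g hg hgh h0 => ?_⟩
  · rw [hP]
    intro g hg
    by_cases hgh : g = h
    · rw [hgh, hw]
    · rw [AffineMap.apply_convexComb g y z hst]
      exact add_nonneg (mul_nonneg hs.le (hyP g hg)) (mul_nonneg ht.le (hz g hg hgh))
  · rw [AffineMap.apply_convexComb g y z hst] at h0
    have h1 := mul_nonneg hs.le (hyP g hg)
    have h2 := mul_nonneg ht.le (hz g hg hgh)
    have h3 : -h z / (h y - h z) * g y = 0 := by linarith
    exact hyT g hg ((mul_eq_zero.1 h3).resolve_left hs.ne')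

theorem finrank_inf_ker_add_one [FiniteDimensional ℝ E] (W : Submodule ℝ E) (f : E →ₗ[ℝ] ℝ)
    {v : E} (hv : v ∈ W) (hfv : f v ≠ 0) :
    Module.finrank ℝ (W ⊓ LinearMap.ker f : Submodule ℝ E) + 1 = Module.finrank ℝ W := by
  have h1 := (f.domRestrict W).finrank_range_add_finrank_ker
  have h2 : LinearMap.range (f.domRestrict W) = ⊤ := by
    apply LinearMap.range_eq_top.2
    apply LinearMap.surjective
    intro h
    exact hfv (by simpa using LinearMap.congr_fun h ⟨v, hv⟩)
  have h3 : Module.finrank ℝ (LinearMap.ker (f.domRestrict W)) =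
      Module.finrank ℝ (W ⊓ LinearMap.ker f : Submodule ℝ E) := by
    rw [LinearMap.ker_domRestrict, ← Submodule.map_comap_subtype]
    exact (Submodule.finrank_map_subtype_eq _ _).symm
  rw [h2, finrank_top, Module.finrank_self] at h1
  omega

/-- From a point where no other inequality than `0 ≤ h` is tight, except for implied equalities,
a polyhedron contains a small step in every direction of its span along which `h` is constant. -/
theorem exists_pos_add_smul_mem_of_tight {P : Set E} {T : Set (E →ᵃ[ℝ] ℝ)} (hT : T.Finite)
    (hP : P = {x | ∀ h ∈ T, 0 ≤ h x}) {h : E →ᵃ[ℝ] ℝ} {w : E} (hw : w ∈ P)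
    (htight : ∀ g ∈ T, g ≠ h → g w = 0 → ∀ y ∈ P, g y = 0) {v : E} (hv : v ∈ vectorSpan ℝ P)
    (hv0 : h.linear v = 0) : ∃ ε : ℝ, 0 < ε ∧ w + ε • v ∈ P := by
  obtain ⟨ε, hε, hmem⟩ := exists_pos_add_smul_nonneg (x := w) (v := v) hT
    (by rw [hP] at hw; exact hw) (fun g hg hg0 => by
      by_cases hgh : g = h
      · rw [hgh]; exact hv0.ge
      · exact (AffineMap.linear_eq_zero_of_mem_vectorSpan (htight g hg hgh hg0) hv).ge)
  exact ⟨ε, hε, by rw [hP]; exact hmem⟩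

/-- The inequality `0 ≤ h` cuts out a facet of a polyhedron if it is tight at a point where all
other tight inequalities are implied equalities. -/
theorem isFacet_of_tight [FiniteDimensional ℝ E] {P : Set E} {T : Set (E →ᵃ[ℝ] ℝ)} (hT : T.Finite)
    (hP : P = {x | ∀ h ∈ T, 0 ≤ h x}) {h : E →ᵃ[ℝ] ℝ} (hh : h ∈ T) {x w : E} (hx : x ∈ P)
    (hxh : 0 < h x) (hw : w ∈ P) (hwh : h w = 0)
    (htight : ∀ g ∈ T, g ≠ h → g w = 0 → ∀ y ∈ P, g y = 0) :
    IsFacet P (P ∩ {x | h x = 0}) := by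
  have hpos : ∀ y ∈ P, 0 ≤ h y := fun y hy => by rw [hP] at hy; exact hy h hh
  refine ⟨fun _ => ⟨-(LinearMap.toContinuousLinearMap h.linear), ?_⟩, ⟨w, hw, hwh⟩, ?_⟩
  · ext y
    constructor
    · rintro ⟨hy, hy0⟩
      refine ⟨hy, fun u hu => ?_⟩
      have := AffineMap.linear_sub_apply h u y
      rw [map_sub, hy0] at this
      have := hpos u hu
      simp
      linarith
    · rintro ⟨hy, hmax⟩
      refine ⟨hy, le_antisymm ?_ (hpos y hy)⟩
      have := AffineMap.linear_sub_apply h w y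
      rw [map_sub, hwh] at this
      have := hmax w hw
      simp at this
      linarith
  · have : vectorSpan ℝ (P ∩ {x | h x = 0}) = vectorSpan ℝ P ⊓ LinearMap.ker h.linear := by
      apply le_antisymm
      · exact le_inf (vectorSpan_mono ℝ Set.inter_subset_left) fun v hv =>
          AffineMap.linear_eq_zero_of_mem_vectorSpan (fun y hy => hy.2) hv
      · rintro v ⟨hv, hv0⟩
        obtain ⟨ε, hε, hmem⟩ := exists_pos_add_smul_mem_of_tight hT hP hw htight hv
          (LinearMap.mem_ker.1 hv0)
        have h1 : w + ε • v ∈ P ∩ {x | h x = 0} := by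
          refine ⟨hmem, ?_⟩
          simp [AffineMap.apply_add_smul, hwh, LinearMap.mem_ker.1 hv0]
        have h2 := vsub_mem_vectorSpan ℝ h1 ⟨hw, hwh⟩
        rw [vsub_eq_sub, add_sub_cancel_left] at h2
        simpa [smul_smul, hε.ne'] using Submodule.smul_mem _ ε⁻¹ h2
    rw [this]
    refine finrank_inf_ker_add_one _ _ (vsub_mem_vectorSpan ℝ hx hw) ?_
    rw [vsub_eq_sub, AffineMap.linear_sub_apply, hwh]
    linarith

/-- The face of a convex hull on which a nonnegative affine functional vanishes is the convex hull
of the generators it contains. -/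
theorem convexHull_inter_eq_zero {S : Set E} {h : E →ᵃ[ℝ] ℝ} (hS : ∀ x ∈ S, 0 ≤ h x) :
    convexHull ℝ S ∩ {x | h x = 0} = convexHull ℝ (S ∩ {x | h x = 0}) := by
  apply Set.Subset.antisymm
  · have hconv : Convex ℝ {x | 0 ≤ h x ∧ (h x = 0 → x ∈ convexHull ℝ (S ∩ {x | h x = 0}))} := by
      rintro x ⟨hx, hx0⟩ y ⟨hy, hy0⟩ s t hs ht hst
      simp only [Set.mem_ofPred_eq]
      rw [AffineMap.apply_convexComb h x y hst]
      have h1 := mul_nonneg hs hx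
      have h2 := mul_nonneg ht hy
      refine ⟨by linarith, fun h0 => ?_⟩
      have h3 : s * h x = 0 := by linarith
      have h4 : t * h y = 0 := by linarith
      rcases mul_eq_zero.1 h3 with rfl | h3
      · obtain rfl : t = 1 := by linarith
        simpa using hy0 (by simpa using h4)
      · rcases mul_eq_zero.1 h4 with rfl | h4
        · obtain rfl : s = 1 := by linarith
          simpa using hx0 (by simpa using h3)
        · exact convex_convexHull ℝ _ (hx0 h3) (hy0 h4) hs ht hst
    rintro x ⟨hx, hx0⟩
    have hsub : S ⊆ {x | 0 ≤ h x ∧ (h x = 0 → x ∈ convexHull ℝ (S ∩ {x | h x = 0}))} :=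
      fun y hy => ⟨hS y hy, fun h0 => subset_convexHull ℝ _ ⟨hy, h0⟩⟩
    exact (convexHull_min hsub hconv hx).2 hx0
  · refine convexHull_min (fun y hy => ⟨subset_convexHull ℝ _ hy.1, hy.2⟩) ?_
    refine (convex_convexHull ℝ S).inter ?_
    intro x hx y hy s t _ _ hst
    simp only [Set.mem_ofPred_eq] at hx hy ⊢
    simp [AffineMap.apply_convexComb h x y hst, hx, hy]

/-- A nonempty exposed face is the zero set of an affine functional that is nonnegative. -/
theorem IsExposed.exists_affineMap {P F : Set E} (hF : IsExposed ℝ P F) (hne : F.Nonempty) :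
    ∃ h : E →ᵃ[ℝ] ℝ, (∀ x ∈ P, 0 ≤ h x) ∧ F = P ∩ {x | h x = 0} := by
  obtain ⟨f, hf⟩ := hF hne
  obtain ⟨w, hw⟩ := hne
  have hw' := hw
  rw [hf] at hw'
  refine ⟨AffineMap.const ℝ E (f w) - (f : E →ₗ[ℝ] ℝ).toAffineMap, fun x hx => ?_, ?_⟩
  · simpa using hw'.2 x hx
  · ext x
    rw [hf]
    simp only [Set.mem_ofPred_eq, Set.mem_inter_iff, AffineMap.coe_sub, Pi.sub_apply,
      AffineMap.const_apply, LinearMap.coe_toAffineMap, sub_eq_zero]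
    refine and_congr_right fun hx => ⟨fun h => le_antisymm (h w hw'.1) (hw'.2 x hx),
      fun h y hy => ?_⟩
    have := hw'.2 y hy
    simp at h
    linarith

theorem eq_zero_of_ray_subset {P : Set E} (hP : Bornology.IsBounded P) {p v : E}
    (h : ∀ t : ℝ, 0 ≤ t → p + t • v ∈ P) : v = 0 := by
  by_contra hv
  obtain ⟨C, hC⟩ := hP.exists_norm_le
  have hv' : 0 < ‖v‖ := norm_pos_iff.2 hv
  have hC0 : 0 ≤ C := (norm_nonneg _).trans (hC _ (h 0 le_rfl))
  have h1 := hC _ (h ((C + ‖p‖ + 1) / ‖v‖) (by positivity))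
  have h2 : ‖((C + ‖p‖ + 1) / ‖v‖) • v‖ = C + ‖p‖ + 1 := by
    rw [norm_smul, Real.norm_of_nonneg (by positivity)]; field_simp
  have h3 := norm_sub_le (p + ((C + ‖p‖ + 1) / ‖v‖) • v) p
  rw [add_sub_cancel_left, h2] at h3
  linarith

end Polyhedra

section Pulling

variable {E : Type*} [NormedAddCommGroup E] [NormedSpace ℝ E]

theorem vectorSpan_convexHull (S : Set E) : vectorSpan ℝ (convexHull ℝ S) = vectorSpan ℝ S := by
  rw [← direction_affineSpan, affineSpan_convexHull, direction_affineSpan]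

/-- Every facet of a polyhedron is cut out by one of the inequalities. -/
theorem IsFacet.exists_mem_eq [FiniteDimensional ℝ E] {P F : Set E} (hF : IsFacet P F)
    {T : Set (E →ᵃ[ℝ] ℝ)} (hT : T.Finite) (hP : P = {x | ∀ h ∈ T, 0 ≤ h x}) :
    ∃ h ∈ T, F = P ∩ {x | h x = 0} ∧
      vectorSpan ℝ F = vectorSpan ℝ P ⊓ LinearMap.ker h.linear := by
  obtain ⟨hexp, hne, hdim⟩ := hF
  obtain ⟨f, hfpos, hfF⟩ := hexp.exists_affineMap hne
  have hFP : F ⊆ P := hfF ▸ Set.inter_subset_left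
  have hPconv : Convex ℝ P := hP ▸ convex_forall_nonneg T
  have hTP : ∀ h ∈ T, ∀ x ∈ P, 0 ≤ h x := fun h hh x hx => by rw [hP] at hx; exact hx h hh
  obtain ⟨y, hy, hyT⟩ := exists_mem_forall_eq_zero_imp (hexp.convex hPconv) hne hT
    (fun h hh x hx => hTP h hh x (hFP hx))
  have hfF' : ∀ x ∈ F, f x = 0 := fun x hx => by rw [hfF] at hx; exact hx.2
  obtain ⟨h, hh, hhy, x, hx, hhx⟩ : ∃ h ∈ T, h y = 0 ∧ ∃ x ∈ P, h x ≠ 0 := by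
    by_contra! hcon
    obtain ⟨x, hx, hfx⟩ : ∃ x ∈ P, f x ≠ 0 := by
      by_contra! h0
      have : F = P := by
        rw [hfF]; exact Set.inter_eq_left.2 h0
      rw [this] at hdim
      omega
    obtain ⟨ε, hε, hmem⟩ := exists_pos_add_smul_nonneg (x := y) (v := y - x) hT
      (fun h hh => hTP h hh y (hFP hy)) (fun h hh h0 => by
        rw [AffineMap.linear_sub_apply, h0, hcon h hh h0 x hx, sub_zero])
    have h1 := hfpos _ (show y + ε • (y - x) ∈ P by rw [hP]; exact hmem)
    rw [AffineMap.apply_add_smul, AffineMap.linear_sub_apply, hfF' y hy] at h1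
    have h2 := mul_pos hε ((hfpos x hx).lt_of_ne hfx.symm)
    linarith
  have hF0 := hyT h hh hhy
  have hspan : vectorSpan ℝ F = vectorSpan ℝ P ⊓ LinearMap.ker h.linear := by
    refine Submodule.eq_of_le_of_finrank_eq ?_ ?_
    · exact le_inf (vectorSpan_mono ℝ hFP) fun v hv =>
        AffineMap.linear_eq_zero_of_mem_vectorSpan hF0 hv
    · have := finrank_inf_ker_add_one (vectorSpan ℝ P) h.linear
        (vsub_mem_vectorSpan ℝ hx (hFP hy))
        (by rwa [vsub_eq_sub, AffineMap.linear_sub_apply, hhy, sub_zero])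
      omega
  refine ⟨h, hh, Set.Subset.antisymm (fun u hu => ⟨hFP hu, hF0 u hu⟩) ?_, hspan⟩
  rintro u ⟨hu, hu0⟩
  have h1 : u - y ∈ vectorSpan ℝ F := by
    rw [hspan]
    refine ⟨vsub_mem_vectorSpan ℝ hu (hFP hy), ?_⟩
    simp only [Set.mem_ofPred_eq] at hu0
    simp [AffineMap.linear_sub_apply, hu0, hhy]
  have h2 := AffineMap.linear_eq_zero_of_mem_vectorSpan hfF' h1
  rw [AffineMap.linear_sub_apply, hfF' y hy, sub_zero] at h2
  rw [hfF]
  exact ⟨hu, h2⟩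

open scoped Classical in
theorem IsFacet.eq_convexHull_filter {P F : Set E} (hF : IsFacet P F) {l : List E}
    (hP : P = convexHull ℝ {x | x ∈ l}) :
    F = convexHull ℝ {x | x ∈ l.filter (fun x => x ∈ F)} := by
  obtain ⟨f, hfpos, hfF⟩ := hF.1.exists_affineMap hF.2.1
  have hl : ∀ x ∈ l, x ∈ P := fun x hx => hP ▸ subset_convexHull ℝ _ hx
  have : {x | x ∈ l.filter (fun x => x ∈ F)} = {x | x ∈ l} ∩ {x | f x = 0} := by
    ext x
    simp only [List.mem_filter, decide_eq_true_eq, Set.mem_ofPred_eq, Set.mem_inter_iff]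
    refine and_congr_right fun hx => ?_
    rw [hfF]
    exact ⟨fun h => h.2, fun h => ⟨hl x hx, h⟩⟩
  rw [this, ← convexHull_inter_eq_zero (S := {x | x ∈ l}) (fun x hx => hfpos x (hl x hx)),
    ← hP, ← hfF]

theorem AffineIndependent.finset_insert [DecidableEq E] {S : Finset E} {p : E}
    (hS : AffineIndependent ℝ (fun x : S => (x : E))) (hp : p ∉ affineSpan ℝ (S : Set E)) :
    AffineIndependent ℝ (fun x : (insert p S : Finset E) => (x : E)) := by
  have hmem : ∀ y : {y : (insert p S : Finset E) // y ≠ ⟨p, Finset.mem_insert_self p S⟩},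
      ((y : (insert p S : Finset E)) : E) ∈ S := by
    rintro ⟨⟨y, hy⟩, hne⟩
    exact (Finset.mem_insert.1 hy).resolve_left fun h => hne (Subtype.ext h)
  refine AffineIndependent.affineIndependent_of_notMem_span
    (i := ⟨p, Finset.mem_insert_self p S⟩) ?_ ?_
  · exact hS.comp_embedding ⟨fun y => ⟨_, hmem y⟩, fun y z h =>
      Subtype.ext (Subtype.ext (Subtype.mk.inj h))⟩
  · intro h
    refine hp (affineSpan_mono ℝ ?_ h)
    rintro _ ⟨y, hy, rfl⟩
    exact hmem ⟨y, hy⟩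

theorem AffineMap.eq_zero_of_mem_affineSpan {h : E →ᵃ[ℝ] ℝ} {S : Set E}
    (hS : ∀ x ∈ S, h x = 0) {x : E} (hx : x ∈ affineSpan ℝ S) : h x = 0 := by
  obtain ⟨y, hy⟩ := (affineSpan_nonempty (k := ℝ) (s := S)).1 ⟨x, hx⟩
  have h1 : x -ᵥ y ∈ vectorSpan ℝ S := by
    rw [← direction_affineSpan]
    exact AffineSubspace.vsub_mem_direction hx (mem_affineSpan ℝ hy)
  have h2 := AffineMap.linear_eq_zero_of_mem_vectorSpan hS h1
  rw [vsub_eq_sub, AffineMap.linear_sub_apply, hS y hy, sub_zero] at h2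
  exact h2

/-- The members of a pulling triangulation of `P` are simplices of dimension `dim P`. -/
theorem IsPullingSimplex.affineIndependent_and_card {P : Set E} {l : List E} {σ : Finset E}
    (hσ : IsPullingSimplex P l σ) (hP : P = convexHull ℝ {x | x ∈ l}) (hne : P.Nonempty) :
    (∀ x ∈ σ, x ∈ l) ∧ AffineIndependent ℝ (fun x : σ => (x : E)) ∧
      σ.card = Module.finrank ℝ (vectorSpan ℝ P) + 1 := by
  classical
  induction hσ with
  | simplex P l h =>
    have hi : AffineIndependent ℝ (fun x : l.toFinset => (x : E)) :=
      h.comp_embedding ⟨fun x => ⟨x.1, List.mem_toFinset.1 x.2⟩, fun x y hxy =>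
        Subtype.ext (Subtype.mk.inj hxy)⟩
    have hl : {x | x ∈ l}.Nonempty := by
      rw [hP] at hne; exact convexHull_nonempty_iff.1 hne
    obtain ⟨x, hx⟩ := hl
    have : Nonempty l.toFinset := ⟨⟨x, List.mem_toFinset.2 hx⟩⟩
    have hc := hi.finrank_vectorSpan_add_one
    refine ⟨fun x hx => by simpa using hx, by convert hi, ?_⟩
    have hr : Set.range (fun x : l.toFinset => (x : E)) = {x | x ∈ l} := by
      ext x; simp
    rw [hr, Fintype.card_coe] at hc
    rw [hP, vectorSpan_convexHull, hc]
  | cone P p t F τ h hF hp hτ ih =>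
    obtain ⟨h1, h2, h3⟩ := ih (hF.eq_convexHull_filter hP) hF.2.1
    obtain ⟨f, hfpos, hfF⟩ := hF.1.exists_affineMap hF.2.1
    have hτF : ∀ x ∈ τ, x ∈ F := fun x hx => by
      have := h1 x hx
      rw [List.mem_filter] at this
      simpa using this.2
    have hpP : p ∈ P := hP ▸ subset_convexHull ℝ _ (by simp)
    have hpτ : p ∉ affineSpan ℝ (τ : Set E) := fun hmem => by
      apply hp
      rw [hfF]
      refine ⟨hpP, AffineMap.eq_zero_of_mem_affineSpan (fun x hx => ?_) hmem⟩
      have := hτF x hx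
      rw [hfF] at this
      exact this.2
    refine ⟨?_, by convert h2.finset_insert hpτ, ?_⟩
    · intro x hx
      rcases Finset.mem_insert.1 hx with rfl | hx
      · simp
      · exact List.mem_of_mem_filter (h1 x hx)
    · rw [Finset.card_insert_of_notMem fun hmem => hp (hτF p hmem), h3, hF.2.2]

/-- A bounded polyhedron with at least two points has a facet that does not contain a given
point. -/
theorem exists_isFacet_notMem [FiniteDimensional ℝ E] {P : Set E} {T : Set (E →ᵃ[ℝ] ℝ)}
    (hT : T.Finite) (hP : P = {x | ∀ h ∈ T, 0 ≤ h x}) (hb : Bornology.IsBounded P) {p q : E}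
    (hp : p ∈ P) (hq : q ∈ P) (hpq : p ≠ q) :
    ∃ h ∈ T, IsFacet P (P ∩ {x | h x = 0}) ∧ h p ≠ 0 := by
  classical
  lift T to Finset (E →ᵃ[ℝ] ℝ) using hT
  obtain ⟨T', hT'T, hmin⟩ := exists_minimal_le_of_wellFoundedLT
    (fun S : Finset (E →ᵃ[ℝ] ℝ) => P = {x | ∀ h ∈ S, 0 ≤ h x}) T hP
  have hP' := hmin.prop
  have hpos : ∀ h ∈ T', ∀ x ∈ P, 0 ≤ h x := fun h hh x hx => by rw [hP'] at hx; exact hx h hh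
  obtain ⟨h, hh, hhp⟩ : ∃ h ∈ T', h p ≠ 0 := by
    by_contra! hcon
    refine hpq (sub_eq_zero.1 (eq_zero_of_ray_subset hb (p := p) (v := q - p) fun t ht => ?_)).symm
    rw [hP']
    intro h hh
    rw [AffineMap.apply_add_smul, AffineMap.linear_sub_apply]
    rw [hcon h hh, zero_add, sub_zero]
    exact mul_nonneg ht (hpos h hh q hq)
  have hhp' : 0 < h p := (hpos h hh p hp).lt_of_ne hhp.symm
  obtain ⟨z, hz, hzh⟩ : ∃ z, (∀ g ∈ T', g ≠ h → 0 ≤ g z) ∧ h z < 0 := by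
    by_contra! hcon
    have h1 : P = {x | ∀ g ∈ T'.erase h, 0 ≤ g x} := by
      rw [hP']
      ext x
      refine ⟨fun hx g hg => hx g (Finset.mem_of_mem_erase hg), fun hx g hg => ?_⟩
      by_cases hgh : g = h
      · rw [hgh]
        exact hcon x fun g hg hgh => hx g (Finset.mem_erase.2 ⟨hgh, hg⟩)
      · exact hx g (Finset.mem_erase.2 ⟨hgh, hg⟩)
    exact Finset.notMem_erase h T' (hmin.le_of_le h1 (Finset.erase_subset _ _) hh)
  have hP'' : P = {x | ∀ h ∈ (T' : Set (E →ᵃ[ℝ] ℝ)), 0 ≤ h x} := hP'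
  obtain ⟨w, hw, hwh, hwT⟩ := exists_tight_of_irredundant T'.finite_toSet hP'' hh
    (fun g hg => hz g hg) hzh hp hhp'
  exact ⟨h, hT'T hh, isFacet_of_tight T'.finite_toSet hP'' hh hp hhp' hw hwh hwT, hhp⟩

theorem forall_nonneg_insert_neg {P : Set E} {T : Set (E →ᵃ[ℝ] ℝ)}
    (hP : P = {x | ∀ h ∈ T, 0 ≤ h x}) {h : E →ᵃ[ℝ] ℝ} (hh : h ∈ T) :
    P ∩ {x | h x = 0} = {x | ∀ g ∈ insert (-h) T, 0 ≤ g x} := by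
  rw [hP]
  ext x
  simp only [Set.mem_inter_iff, Set.mem_ofPred_eq, Set.forall_mem_insert]
  constructor
  · rintro ⟨h1, h2⟩
    exact ⟨by simp [h2], h1⟩
  · rintro ⟨h1, h2⟩
    refine ⟨h2, le_antisymm ?_ (h2 h hh)⟩
    simpa using h1

theorem exists_isPullingSimplex [FiniteDimensional ℝ E] {P : Set E} {T : Set (E →ᵃ[ℝ] ℝ)}
    (hT : T.Finite) (hP : P = {x | ∀ h ∈ T, 0 ≤ h x}) {l : List E}
    (hl : P = convexHull ℝ {x | x ∈ l}) : ∃ σ, IsPullingSimplex P l σ := by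
  classical
  induction hk : Module.finrank ℝ (vectorSpan ℝ P) generalizing P T l with
  | zero =>
    refine ⟨_, .simplex P l ?_⟩
    have hsub : {x | x ∈ l}.Subsingleton := by
      rw [hl, vectorSpan_convexHull, Submodule.finrank_eq_zero,
        vectorSpan_eq_bot_iff_subsingleton] at hk
      exact hk
    have : Subsingleton {x // x ∈ l} := ⟨fun x y => Subtype.ext (hsub x.2 y.2)⟩
    exact affineIndependent_of_subsingleton ℝ _
  | succ k ih =>
    by_cases hi : AffineIndependent ℝ (fun x : {x // x ∈ l} => (x : E))
    · exact ⟨_, .simplex P l hi⟩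
    cases l with
    | nil =>
      have : IsEmpty {x : E // x ∈ ([] : List E)} := ⟨fun x => by simpa using x.2⟩
      exact absurd (affineIndependent_of_subsingleton ℝ _) hi
    | cons p t =>
      have hpP : p ∈ P := hl ▸ subset_convexHull ℝ _ (by simp)
      obtain ⟨q, hq, hpq⟩ : ∃ q ∈ P, p ≠ q := by
        by_contra! hcon
        have : vectorSpan ℝ P = ⊥ := by
          rw [vectorSpan_eq_bot_iff_subsingleton]
          exact fun x hx y hy => (hcon x hx).symm.trans (hcon y hy)
        rw [this] at hk
        simp at hk
      have hb : Bornology.IsBounded P := by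
        rw [hl]
        exact (isBounded_convexHull).2 (List.finite_toSet _).isBounded
      obtain ⟨h, hh, hF, hp0⟩ := exists_isFacet_notMem hT hP hb hpP hq hpq
      obtain ⟨τ, hτ⟩ := ih (hT.insert (-h)) (forall_nonneg_insert_neg hP hh)
        (hF.eq_convexHull_filter hl) (by have := hF.2.2; omega)
      exact ⟨_, .cone P p t _ τ hi hF (fun hmem => hp0 hmem.2) hτ⟩

open scoped Classical in
/-- If two points `p` and `q` off a facet are pulled first, in either order, the pulling
triangulation contains pyramids with these apexes over a common simplex in the facet. -/
theorem IsFacet.exists_isPullingSimplex_insert [FiniteDimensional ℝ E] {P F : Set E}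
    (hF : IsFacet P F) {T : Set (E →ᵃ[ℝ] ℝ)} (hT : T.Finite)
    (hdesc : F = {x | ∀ h ∈ T, 0 ≤ h x}) {p q : E} (hpq : p ≠ q) (hp : p ∉ F) (hq : q ∉ F)
    {R : List E} (hl : P = convexHull ℝ {x | x ∈ p :: q :: R}) :
    ∃ (τ : Set E) (σ σ' : Finset E), τ ⊆ F ∧ (σ : Set E) = insert p τ ∧
      (σ' : Set E) = insert q τ ∧ IsPullingSimplex P (p :: q :: R) σ ∧
      IsPullingSimplex P (q :: p :: R) σ' := by
  have hFR : F = convexHull ℝ {x | x ∈ R.filter (fun x => x ∈ F)} := by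
    have := hF.eq_convexHull_filter hl
    rwa [List.filter_cons_of_neg (by simpa using hp),
      List.filter_cons_of_neg (by simpa using hq)] at this
  obtain ⟨τ, hτ⟩ := exists_isPullingSimplex hT hdesc hFR
  obtain ⟨hτR, -, hτc⟩ := hτ.affineIndependent_and_card hFR hF.2.1
  have hτF : ∀ x ∈ τ, x ∈ F := fun x hx => by simpa using (List.mem_filter.1 (hτR x hx)).2
  have key : ∀ p q, p ≠ q → p ∉ F → q ∉ F → P = convexHull ℝ {x | x ∈ p :: q :: R} →
      IsPullingSimplex P (p :: q :: R) (insert p τ) := by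
    intro p q hpq hp hq hl
    refine .cone P p (q :: R) F τ (fun hi => ?_) hF hp ?_
    · obtain ⟨-, -, hc⟩ := (IsPullingSimplex.simplex P _ hi).affineIndependent_and_card
        hl ⟨p, hl ▸ subset_convexHull ℝ _ (by simp)⟩
      have hsub : insert p (insert q τ) ⊆ (p :: q :: R).toFinset := by
        intro x hx
        simp only [Finset.mem_insert] at hx
        simp only [List.mem_toFinset, List.mem_cons]
        rcases hx with h | h | h
        · exact Or.inl h
        · exact Or.inr (Or.inl h)
        · exact Or.inr (Or.inr (List.mem_of_mem_filter (hτR x h)))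
      have hle := Finset.card_le_card hsub
      have hqτ : q ∉ τ := fun h => hq (hτF q h)
      have hpτ : p ∉ insert q τ := by
        rw [Finset.mem_insert]
        exact fun h => h.elim hpq fun h => hp (hτF p h)
      rw [Finset.card_insert_of_notMem hpτ, Finset.card_insert_of_notMem hqτ, hτc, hF.2.2] at hle
      omega
    · rw [List.filter_cons_of_neg (by simpa using hp), List.filter_cons_of_neg (by simpa using hq)]
      exact hτ
  refine ⟨τ, insert p τ, insert q τ, hτF, Finset.coe_insert _ _, Finset.coe_insert _ _,
    key p q hpq hp hq hl, key q p hpq.symm hq hp ?_⟩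
  rw [hl]
  congr 1
  ext x
  simp only [List.mem_cons, Set.mem_ofPred_eq]
  tauto

end Pulling

section Unimodular

variable {E : Type*} [NormedAddCommGroup E] [NormedSpace ℝ E]

theorem AffineMap.map_finset_sum_smul (h : E →ᵃ[ℝ] ℝ) {σ : Finset E} {w : E → ℝ}
    (hw : ∑ v ∈ σ, w v = 1) : h (∑ v ∈ σ, w v • v) = ∑ v ∈ σ, w v * h v := by
  have h1 := σ.map_affineCombination (fun v : E => v) w hw h
  rw [Finset.affineCombination_eq_linear_combination _ _ _ hw,
    Finset.affineCombination_eq_linear_combination _ _ _ hw] at h1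
  simpa using h1

theorem exists_weights_of_mem_affineSpan {σ : Finset E} {x : E}
    (hx : x ∈ affineSpan ℝ (σ : Set E)) :
    ∃ w : E → ℝ, ∑ v ∈ σ, w v = 1 ∧ ∑ v ∈ σ, w v • v = x := by
  classical
  rw [← Set.image_id (σ : Set E)] at hx
  obtain ⟨s, w, hs, hw, hsum⟩ := eq_affineCombination_of_mem_affineSpan_image hx
  rw [Finset.affineCombination_eq_linear_combination _ _ _ hw] at hsum
  refine ⟨fun v => if v ∈ s then w v else 0, ?_, ?_⟩
  · rw [← hw, ← Finset.sum_filter]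
    congr 1
    ext v
    simpa using fun h => hs h
  · simp only [ite_smul, zero_smul]
    rw [hsum, ← Finset.sum_filter]
    refine Finset.sum_congr ?_ fun _ _ => rfl
    ext v
    simpa using fun h => hs h

/-- In a simplex given by inequalities, some inequality is tight at all vertices but a given
one. -/
theorem exists_eq_zero_of_ne_of_affineIndependent {P : Set E} {T : Set (E →ᵃ[ℝ] ℝ)}
    (hT : T.Finite) (hP : P = {x | ∀ h ∈ T, 0 ≤ h x}) {S : Set E} (hS : P = convexHull ℝ S)
    (hi : AffineIndependent ℝ (fun x : S => (x : E))) {u v : E} (hu : u ∈ S) (hv : v ∈ S)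
    (huv : u ≠ v) : ∃ h ∈ T, h v ≠ 0 ∧ ∀ x ∈ S, x ≠ v → h x = 0 := by
  have hTP : ∀ h ∈ T, ∀ x ∈ P, 0 ≤ h x := fun h hh x hx => by rw [hP] at hx; exact hx h hh
  have hne : (S \ {v}).Nonempty := ⟨u, hu, huv⟩
  have hsub : convexHull ℝ (S \ {v}) ⊆ P := hS ▸ convexHull_mono Set.sdiff_subset
  obtain ⟨y, hy, hyT⟩ := exists_mem_forall_eq_zero_imp (convex_convexHull ℝ (S \ {v}))
    (convexHull_nonempty_iff.2 hne) hT (fun h hh x hx => hTP h hh x (hsub hx))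
  by_contra! hcon
  obtain ⟨ε, hε, hmem⟩ := exists_pos_add_smul_nonneg (x := y) (v := y - v) hT
    (fun h hh => hTP h hh y (hsub hy)) (fun h hh h0 => by
      rw [AffineMap.linear_sub_apply, h0]
      by_contra hneg
      obtain ⟨x, hx, hxv, hx0⟩ := hcon h hh (fun h0 => hneg (by simp [h0]))
      exact hx0 (hyT h hh h0 x (subset_convexHull ℝ _ ⟨hx, hxv⟩)))
  have hmem' : y + ε • (y - v) ∈ convexHull ℝ (insert v (S \ {v})) := by
    rw [Set.insert_sdiff_singleton, Set.insert_eq_of_mem hv, ← hS, hP]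
    exact hmem
  rw [convexHull_insert hne, mem_convexJoin] at hmem'
  obtain ⟨v', rfl, s, hs, a, b, ha, hb, hab, heq⟩ := hmem'
  have hspan : y - s ∈ (affineSpan ℝ (S \ {v'})).direction := by
    rw [direction_affineSpan, ← vectorSpan_convexHull]
    exact vsub_mem_vectorSpan ℝ hy hs
  have hyspan : y ∈ affineSpan ℝ (S \ {v'}) := convexHull_subset_affineSpan _ hy
  have hv' : v' = (b / (a + ε)) • (y - s) +ᵥ y := by
    have h1 : a + ε ≠ 0 := by positivity
    obtain rfl : a = 1 - b := by linarith
    have h2 : (1 - b + ε) • v' = b • (y - s) + (1 - b + ε) • y := by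
      linear_combination (norm := module) heq
    have h3 := congrArg (fun x => (1 - b + ε)⁻¹ • x) h2
    simp only [smul_add, smul_smul, inv_mul_cancel₀ h1, one_smul] at h3
    rw [h3, div_eq_inv_mul, vadd_eq_add]
  have hvmem : v' ∈ affineSpan ℝ (S \ {v'}) := by
    have := AffineSubspace.vadd_mem_of_mem_direction
      (Submodule.smul_mem _ (b / (a + ε)) hspan) hyspan
    rwa [← hv'] at this
  refine hi.notMem_affineSpan_sdiff ⟨v', hv⟩ Set.univ ?_
  convert hvmem using 2
  ext x
  simp [and_comm]

/-- If all inequalities of a polytope take only the values `0` and `1` on its generating points,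
then every simplex of a pulling triangulation generates, by integral affine combinations, all
points at which the inequalities take integral values. -/
theorem IsPullingSimplex.exists_int_weights [FiniteDimensional ℝ E] {P : Set E} {l : List E}
    {σ : Finset E} (hσ : IsPullingSimplex P l σ) (hl : P = convexHull ℝ {x | x ∈ l})
    {T : Set (E →ᵃ[ℝ] ℝ)} (hT : T.Finite) (hP : P = {x | ∀ h ∈ T, 0 ≤ h x})
    (hlevel : ∀ h ∈ T, ∀ x ∈ l, h x = 0 ∨ h x = 1) {x : E} (hx : x ∈ affineSpan ℝ P)
    (hint : ∀ h ∈ T, ∃ k : ℤ, h x = k) :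
    ∃ w : E → ℤ, ∑ v ∈ σ, w v = 1 ∧ ∑ v ∈ σ, (w v : ℝ) • v = x := by
  classical
  induction hσ generalizing T x with
  | simplex P l h =>
    have hcoe : ((l.toFinset : Finset E) : Set E) = {x | x ∈ l} := by ext; simp
    rw [hl, affineSpan_convexHull, ← hcoe] at hx
    obtain ⟨w, hw, hwx⟩ := exists_weights_of_mem_affineSpan hx
    have hwint : ∀ v ∈ l, ∃ k : ℤ, w v = k := by
      intro v hv
      by_cases hu : ∃ u ∈ l, u ≠ v
      · obtain ⟨u, hu, huv⟩ := hu
        obtain ⟨h, hh, hhv, hh0⟩ := exists_eq_zero_of_ne_of_affineIndependent hT hP hl h hu hv huv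
        have hhv1 := (hlevel h hh v hv).resolve_left hhv
        obtain ⟨k, hk⟩ := hint h hh
        refine ⟨k, ?_⟩
        rw [← hk, ← hwx, AffineMap.map_finset_sum_smul h hw,
          Finset.sum_eq_single_of_mem v (by simpa using hv), hhv1, mul_one]
        intro y hy hyv
        rw [hh0 y (by simpa using hy) hyv, mul_zero]
      · push Not at hu
        refine ⟨1, ?_⟩
        rw [Finset.sum_eq_single_of_mem v (by simpa using hv)
          (fun y hy hyv => absurd (hu y (by simpa using hy)) hyv)] at hw
        simp [hw]
    choose! k hk using hwint
    refine ⟨k, ?_, ?_⟩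
    · have : ((∑ v ∈ l.toFinset, k v : ℤ) : ℝ) = 1 := by
        rw [← hw]
        push_cast
        exact Finset.sum_congr rfl fun v hv => (hk v (by simpa using hv)).symm
      convert (by exact_mod_cast this : ∑ v ∈ l.toFinset, k v = 1)
    · rw [← hwx]
      refine Finset.sum_congr (by congr) fun v hv => ?_
      rw [hk v (by simpa using hv)]
  | cone P p t F τ h hF hp hτ ih =>
    obtain ⟨h, hh, hFh, hspan⟩ := hF.exists_mem_eq hT hP
    have hlF := hF.eq_convexHull_filter hl
    obtain ⟨hτl, -, hcard⟩ := hτ.affineIndependent_and_card hlF hF.2.1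
    obtain ⟨v, hv⟩ : τ.Nonempty := Finset.card_pos.1 (by omega)
    have hτF : ∀ x ∈ τ, x ∈ F := fun x hx => by
      have := hτl x hx
      rw [List.mem_filter] at this
      simpa using this.2
    have hF0 : ∀ x ∈ F, h x = 0 := fun x hx => by rw [hFh] at hx; exact hx.2
    have hFP : F ⊆ P := hFh ▸ Set.inter_subset_left
    have hvl : v ∈ p :: t := List.mem_of_mem_filter (hτl v hv)
    have hpl : p ∈ p :: t := by simp
    have hpP : p ∈ P := hl ▸ subset_convexHull ℝ _ hpl
    have hhp : h p = 1 := (hlevel h hh p hpl).resolve_left fun h0 =>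
      hp (by rw [hFh]; exact ⟨hpP, h0⟩)
    have hhv : h v = 0 := hF0 v (hτF v hv)
    obtain ⟨k, hk⟩ := hint h hh
    have heval : ∀ g : E →ᵃ[ℝ] ℝ, g (x + (-k : ℝ) • (p - v)) = g x - k * (g p - g v) := by
      intro g
      rw [AffineMap.apply_add_smul, AffineMap.linear_sub_apply]
      ring
    have hxF : x + (-k : ℝ) • (p - v) ∈ affineSpan ℝ F := by
      have h1 : x + (-k : ℝ) • (p - v) - v ∈ (affineSpan ℝ F).direction := by
        rw [direction_affineSpan, hspan]
        refine ⟨?_, ?_⟩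
        · have h2 : x - v ∈ vectorSpan ℝ P := by
            rw [← direction_affineSpan]
            exact AffineSubspace.vsub_mem_direction hx (mem_affineSpan ℝ (hFP (hτF v hv)))
          have h3 : p - v ∈ vectorSpan ℝ P := vsub_mem_vectorSpan ℝ hpP (hFP (hτF v hv))
          have := add_mem h2 (Submodule.smul_mem _ (-k : ℝ) h3)
          rwa [sub_add_eq_add_sub] at this
        · rw [SetLike.mem_coe, LinearMap.mem_ker, AffineMap.linear_sub_apply, heval, hhp, hhv, hk]
          ring
      simpa using AffineSubspace.vadd_mem_of_mem_direction h1 (mem_affineSpan ℝ (hτF v hv))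
    have hlev : ∀ g ∈ T, ∀ y ∈ p :: t, ∃ m : ℤ, g y = m := fun g hg y hy => by
      rcases hlevel g hg y hy with h0 | h0
      · exact ⟨0, by simp [h0]⟩
      · exact ⟨1, by simp [h0]⟩
    have hint' : ∀ g ∈ T, ∃ m : ℤ, g (x + (-k : ℝ) • (p - v)) = m := fun g hg => by
      obtain ⟨m, hm⟩ := hint g hg
      obtain ⟨a, ha⟩ := hlev g hg p hpl
      obtain ⟨b, hb⟩ := hlev g hg v hvl
      exact ⟨m - k * (a - b), by rw [heval, hm, ha, hb]; push_cast; ring⟩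
    obtain ⟨w, hw, hwx⟩ := ih hlF (hT.insert (-h))
      (hFh.trans (forall_nonneg_insert_neg hP hh))
      (by
        rintro g (rfl | hg) y hy
        · have : y ∈ F := by simpa using (List.mem_filter.1 hy).2
          left
          simp [hF0 y this]
        · exact hlevel g hg y (List.mem_of_mem_filter hy))
      hxF
      (by
        rintro g (rfl | hg)
        · obtain ⟨m, hm⟩ := hint' h hh
          refine ⟨-m, ?_⟩
          rw [AffineMap.coe_neg, Pi.neg_apply, hm]
          simp
        · exact hint' g hg)
    have hpτ : p ∉ τ := fun hmem => hp (hτF p hmem)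
    have hneτ : ∀ u ∈ τ, u ≠ p := fun u hu hup => hpτ (hup ▸ hu)
    refine ⟨fun u => if u = p then k else w u - if u = v then k else 0, ?_, ?_⟩
    · rw [Finset.sum_insert hpτ, Finset.sum_congr rfl fun u hu => if_neg (hneτ u hu),
        Finset.sum_sub_distrib, hw, Finset.sum_ite_eq' τ v]
      simp [hv]
    · rw [Finset.sum_insert hpτ]
      have : ∀ u ∈ τ, ((if u = p then k else w u - if u = v then k else 0 : ℤ) : ℝ) • u =
          (w u : ℝ) • u - if u = v then (k : ℝ) • u else 0 := by
        intro u hu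
        rw [if_neg (hneτ u hu)]
        split_ifs <;> simp [sub_smul]
      rw [Finset.sum_congr rfl this, Finset.sum_sub_distrib, hwx, Finset.sum_ite_eq' τ v]
      simp only [if_true, hv]
      module

end Unimodular

section Volume

open MeasureTheory

variable {E : Type*} [NormedAddCommGroup E] [InnerProductSpace ℝ E]

theorem isometry_add_coe (W : Submodule ℝ E) (c : E) : Isometry (fun w : W => c + (w : E)) :=
  Isometry.of_dist_eq fun x y => by simp [Subtype.dist_eq]

theorem exists_image_add_coe_eq (W : Submodule ℝ E) {c : E} {S : Set E}
    (hS : ∀ x ∈ S, x - c ∈ W) : ∃ S' : Set W, (fun w : W => c + (w : E)) '' S' = S := by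
  refine ⟨{w | c + (w : E) ∈ S}, ?_⟩
  ext x
  constructor
  · rintro ⟨w, hw, rfl⟩
    exact hw
  · intro hx
    exact ⟨⟨x - c, hS x hx⟩, by simpa using hx, by simp⟩

theorem sub_mem_of_mem_convexHull {W : Submodule ℝ E} {c : E} {S : Set E}
    (hS : ∀ x ∈ S, x - c ∈ W) : ∀ x ∈ convexHull ℝ S, x - c ∈ W := by
  refine convexHull_min (t := {x | x - c ∈ W}) hS ?_
  intro x hx y hy s t _ _ hst
  have : s • x + t • y - c = s • (x - c) + t • (y - c) := by
    obtain rfl : s = 1 - t := by linarith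
    module
  simp only [Set.mem_ofPred_eq] at hx hy ⊢
  rw [this]
  exact add_mem (W.smul_mem _ hx) (W.smul_mem _ hy)

variable [FiniteDimensional ℝ E] [MeasurableSpace E] [BorelSpace E]

/-- Scaling of the Hausdorff measure of the dimension of a subspace `W` under affine maps that
preserve the direction `W`. -/
theorem euclideanHausdorffMeasure_image_affineMap (W : Submodule ℝ E) (f : E →ᵃ[ℝ] E)
    (A : W →ₗ[ℝ] W) (hA : ∀ w : W, f.linear w = A w) {c : E} {S : Set E}
    (hS : ∀ x ∈ S, x - c ∈ W) :
    μHE[Module.finrank ℝ W] (f '' S) =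
      ENNReal.ofReal |LinearMap.det A| * μHE[Module.finrank ℝ W] S := by
  obtain ⟨S', rfl⟩ := exists_image_add_coe_eq W hS
  have h1 : f '' ((fun w : W => c + (w : E)) '' S') =
      (fun w : W => f c + (w : E)) '' (A '' S') := by
    rw [Set.image_image, Set.image_image]
    refine Set.image_congr fun w _ => ?_
    have := f.map_vadd c (w : E)
    rw [vadd_eq_add, vadd_eq_add, hA] at this
    rw [add_comm, this, add_comm]
  rw [h1, (isometry_add_coe W _).euclideanHausdorffMeasure_image,
    (isometry_add_coe W _).euclideanHausdorffMeasure_image, Measure.addHaar_image_linearMap]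

theorem euclideanHausdorffMeasure_convexHull_ne_top (W : Submodule ℝ E) {c : E} {τ : Finset E}
    (hτ : ∀ x ∈ convexHull ℝ (τ : Set E), x - c ∈ W) :
    μHE[Module.finrank ℝ W] (convexHull ℝ (τ : Set E)) ≠ ⊤ := by
  have hb : Bornology.IsBounded (convexHull ℝ (τ : Set E)) :=
    isBounded_convexHull.2 τ.finite_toSet.isBounded
  obtain ⟨S', hS'⟩ := exists_image_add_coe_eq W hτ
  rw [← hS'] at hb ⊢
  rw [(isometry_add_coe W _).euclideanHausdorffMeasure_image]
  exact (((isometry_add_coe W c).antilipschitz.isBounded_preimage hb).subset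
    (Set.subset_preimage_image _ _)).measure_lt_top.ne

theorem euclideanHausdorffMeasure_convexHull_ne_zero (W : Submodule ℝ E) {c : E} {τ : Finset E}
    (hτ : ∀ x ∈ τ, x - c ∈ W) (hi : AffineIndependent ℝ (fun x : τ => (x : E)))
    (hcard : τ.card = Module.finrank ℝ W + 1) :
    μHE[Module.finrank ℝ W] (convexHull ℝ (τ : Set E)) ≠ 0 := by
  let φ : W →ᵃ[ℝ] E := W.subtype.toAffineMap + AffineMap.const ℝ W c
  have hφ : ∀ w, φ w = c + w := fun w => by simp [φ, add_comm]
  let q : τ → W := fun x => ⟨x - c, hτ x x.2⟩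
  have hq : AffineIndependent ℝ q := by
    refine AffineIndependent.of_comp φ ?_
    convert hi using 1
    ext1 x
    simp [hφ, q]
  have hspan : affineSpan ℝ (Set.range q) = ⊤ := by
    rw [hq.affineSpan_eq_top_iff_card_eq_finrank_add_one, Fintype.card_coe, hcard]
  have hint := interior_convexHull_nonempty_iff_affineSpan_eq_top.2 hspan
  have himg : (τ : Set E) = φ '' Set.range q := by
    ext x
    constructor
    · exact fun hx => ⟨q ⟨x, hx⟩, ⟨_, rfl⟩, by simp [hφ, q]⟩
    · rintro ⟨_, ⟨y, rfl⟩, rfl⟩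
      simp [hφ, q]
  rw [himg, ← AffineMap.image_convexHull, show ⇑φ = fun w : W => c + (w : E) from funext hφ,
    (isometry_add_coe W _).euclideanHausdorffMeasure_image]
  exact (Measure.measure_pos_of_nonempty_interior _ hint).ne'

/-- A simplex whose vertices are integral affine combinations of the vertices of a simplex `σ` of
the same dimension has at least the volume of `σ`. -/
theorem euclideanHausdorffMeasure_le_of_int_weights [DecidableEq E] (W : Submodule ℝ E)
    {σ τ : Finset E} (hσ : ∀ x ∈ σ, ∀ y ∈ σ, x - y ∈ W)
    (hσi : AffineIndependent ℝ (fun x : σ => (x : E))) (hσc : σ.card = Module.finrank ℝ W + 1)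
    (hτ : ∀ x ∈ τ, ∀ y ∈ τ, x - y ∈ W)
    (hτi : AffineIndependent ℝ (fun x : τ => (x : E))) (hτc : τ.card = Module.finrank ℝ W + 1)
    (hint : ∀ x ∈ τ, ∃ w : E → ℤ, ∑ v ∈ σ, w v = 1 ∧ ∑ v ∈ σ, (w v : ℝ) • v = x) :
    μHE[Module.finrank ℝ W] (convexHull ℝ (σ : Set E)) ≤
      μHE[Module.finrank ℝ W] (convexHull ℝ (τ : Set E)) := by
  obtain ⟨v₀, hv₀⟩ : σ.Nonempty := Finset.card_pos.1 (by omega)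
  let e : σ ≃ τ := Finset.equivOfCardEq (hσc.trans hτc.symm)
  let o : σ := ⟨v₀, hv₀⟩
  have hli := (affineIndependent_iff_linearIndependent_vsub ℝ _ o).1 hσi
  let u : {x : σ // x ≠ o} → W := fun i => ⟨(i : σ) - v₀, hσ _ (i : σ).2 _ hv₀⟩
  have hu : LinearIndependent ℝ u := LinearIndependent.of_comp W.subtype hli
  have hcard : Fintype.card {x : σ // x ≠ o} = Module.finrank ℝ W := by
    rw [Fintype.card_subtype_compl, Fintype.card_coe, hσc]
    simp
  let b : Module.Basis {x : σ // x ≠ o} ℝ W :=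
    Module.Basis.mk hu (hu.span_eq_top_of_card_eq_finrank' hcard).ge
  have hb : ∀ i, (b i : E) = (i : σ) - v₀ := fun i => by simp [b, u]
  choose! w hw hwx using hint
  have hsum : ∀ x ∈ τ, x - v₀ = ∑ i : {x : σ // x ≠ o}, (w x (i : σ) : ℝ) • (b i : E) := by
    intro x hx
    have h1 : x - v₀ = ∑ v ∈ σ, (w x v : ℝ) • (v - v₀) := by
      have h2 : ((∑ v ∈ σ, w x v : ℤ) : ℝ) = 1 := by rw [hw x hx]; simp
      push_cast at h2
      simp_rw [smul_sub, Finset.sum_sub_distrib, ← Finset.sum_smul, h2, hwx x hx, one_smul]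
    rw [h1, ← Finset.sum_coe_sort, Fintype.sum_eq_add_sum_subtype_ne _ o]
    simp [hb, o]
  let M : Matrix {x : σ // x ≠ o} {x : σ // x ≠ o} ℤ :=
    Matrix.of fun i j => w (e j) (i : σ) - w (e o) (i : σ)
  let A : W →ₗ[ℝ] W := Matrix.toLin b b (M.map (Int.cast : ℤ → ℝ))
  have hA : ∀ j, (A (b j) : E) = e j - e o := by
    intro j
    have h1 : (e j : E) - e o = ((e j : E) - v₀) - (e o - v₀) := by abel
    rw [h1, hsum _ (e j).2, hsum _ (e o).2, ← Finset.sum_sub_distrib, Matrix.toLin_self,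
      Submodule.coe_sum]
    refine Finset.sum_congr rfl fun i _ => ?_
    simp [M, sub_smul]
  have hdet : LinearMap.det A = (M.det : ℝ) := by
    rw [LinearMap.det_toLin]
    exact (RingHom.map_det (Int.castRingHom ℝ) M).symm
  obtain ⟨g, hg⟩ := LinearMap.exists_extend (W.subtype ∘ₗ A)
  have hg' : ∀ w : W, g w = A w := fun w => LinearMap.congr_fun hg w
  let f : E →ᵃ[ℝ] E := g.toAffineMap + AffineMap.const ℝ E ((e o : E) - g v₀)
  have hf : ∀ x, f x = g (x - v₀) + e o := fun x => by simp [f, map_sub]; abel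
  have hfe : ∀ x : σ, f x = e x := by
    intro x
    rw [hf]
    by_cases hx : x = o
    · simp [hx, o]
    · have := hb ⟨x, hx⟩
      simp only at this
      rw [← this, hg', hA]
      simp
  have himg : f '' (σ : Set E) = τ := by
    ext x
    constructor
    · rintro ⟨y, hy, rfl⟩
      rw [hfe ⟨y, hy⟩]
      exact (e _).2
    · intro hx
      exact ⟨e.symm ⟨x, hx⟩, (e.symm ⟨x, hx⟩).2, by rw [hfe]; simp⟩
  have hvol := euclideanHausdorffMeasure_image_affineMap W f A (fun w => by simp [f, hg'])
    (sub_mem_of_mem_convexHull fun x hx => hσ x hx v₀ hv₀)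
  rw [AffineMap.image_convexHull, himg, hdet] at hvol
  have hpos := euclideanHausdorffMeasure_convexHull_ne_zero W
    (fun x hx => hτ x hx _ (e o).2) hτi hτc
  have hM : M.det ≠ 0 := by
    intro h0
    rw [h0] at hvol
    simp at hvol
    exact hpos hvol
  have hM1 : (1 : ℝ) ≤ |(M.det : ℝ)| := by
    exact_mod_cast Int.one_le_abs hM
  rw [hvol]
  calc _ = 1 * μHE[Module.finrank ℝ W] (convexHull ℝ (σ : Set E)) := (one_mul _).symm
    _ ≤ _ := by
      gcongr
      exact ENNReal.one_le_ofReal.2 hM1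

/-- Replacing the apex `p` of a simplex by `q` multiplies the volume by the ratio of the heights
over the opposite facet. -/
theorem euclideanHausdorffMeasure_convexHull_insert (W : Submodule ℝ E) {τ : Set E}
    {h : E →ᵃ[ℝ] ℝ} (hτ : ∀ x ∈ τ, h x = 0) {p q : E} (hp : 0 < h p) (hq : 0 < h q)
    (hpW : ∀ x ∈ τ, x - p ∈ W) (hqW : q - p ∈ W) :
    μHE[Module.finrank ℝ W] (convexHull ℝ (insert q τ)) =
      ENNReal.ofReal (h q / h p) * μHE[Module.finrank ℝ W] (convexHull ℝ (insert p τ)) := by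
  let φ : Module.Dual ℝ W := (h p)⁻¹ • (h.linear.domRestrict W)
  let A : W →ₗ[ℝ] W := LinearMap.transvection φ ⟨q - p, hqW⟩
  let f : E →ᵃ[ℝ] E := AffineMap.id ℝ E +
    ((h p)⁻¹ • LinearMap.toSpanSingleton ℝ E (q - p)).toAffineMap.comp h
  have hf : ∀ x, f x = x + ((h p)⁻¹ * h x) • (q - p) := fun x => by simp [f, smul_smul]
  have hvol := euclideanHausdorffMeasure_image_affineMap W f A (c := p) (fun w => by
      simp [f, A, φ, LinearMap.transvection.apply, smul_smul])
    (sub_mem_of_mem_convexHull (S := insert p τ) (by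
      rintro x (rfl | hx)
      · simp
      · exact hpW x hx))
  have hdet : LinearMap.det A = h q / h p := by
    rw [LinearMap.transvection.det]
    simp only [φ, LinearMap.smul_apply, LinearMap.domRestrict_apply, smul_eq_mul,
      AffineMap.linear_sub_apply]
    field_simp
    ring
  have himg : f '' (insert p τ) = insert q τ := by
    rw [Set.image_insert_eq]
    congr 1
    · rw [hf, inv_mul_cancel₀ hp.ne']; simp
    · have : Set.EqOn f id τ := fun x hx => by simp [hf, hτ x hx]
      rw [this.image_eq, Set.image_id]
  rw [AffineMap.image_convexHull, himg, hdet, abs_of_pos (div_pos hq hp)] at hvol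
  exact hvol

end Volume

section Compressed

open MeasureTheory

variable {d : ℕ}

theorem IsLatticePolytope.isBounded {E : Type*} [NormedAddCommGroup E] [NormedSpace ℝ E]
    {Λ : Submodule ℤ E} {P : Set E} (hP : IsLatticePolytope Λ P) : Bornology.IsBounded P := by
  obtain ⟨s, -, rfl⟩ := hP
  exact isBounded_convexHull.2 s.finite_toSet.isBounded

theorem IsLatticePolytope.eq_convexHull {E : Type*} [NormedAddCommGroup E] [NormedSpace ℝ E]
    {Λ : Submodule ℤ E} {P : Set E} (hP : IsLatticePolytope Λ P) :
    P = convexHull ℝ (P ∩ Λ) := by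
  obtain ⟨s, hs, rfl⟩ := hP
  refine Set.Subset.antisymm
    (convexHull_mono fun x hx => ⟨subset_convexHull ℝ _ hx, hs hx⟩) ?_
  exact convexHull_min Set.inter_subset_left (convex_convexHull ℝ _)

theorem finite_inter_of_isBounded {Λ : Submodule ℤ (EuclideanSpace ℝ (Fin d))}
    [DiscreteTopology Λ] {P : Set (EuclideanSpace ℝ (Fin d))} (hP : Bornology.IsBounded P) :
    (P ∩ Λ).Finite := by
  have : DiscreteTopology Λ.toAddSubgroup := ‹DiscreteTopology Λ›
  exact Metric.finite_isBounded_inter_isClosed DiscreteTopology.isDiscrete hP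
    (AddSubgroup.isClosed_of_discrete (H := Λ.toAddSubgroup))

theorem simplexVolume_ne_zero_and_ne_top {P : Set (EuclideanSpace ℝ (Fin d))}
    {τ : Finset (EuclideanSpace ℝ (Fin d))} (hτ : ∀ x ∈ τ, x ∈ P)
    (hi : AffineIndependent ℝ (fun x : τ => (x : EuclideanSpace ℝ (Fin d))))
    (hcard : τ.card = Module.finrank ℝ (vectorSpan ℝ P) + 1) :
    simplexVolume P τ ≠ 0 ∧ simplexVolume P τ ≠ ⊤ := by
  obtain ⟨c, hc⟩ : τ.Nonempty := Finset.card_pos.1 (by omega)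
  have hsub : ∀ x ∈ τ, x - c ∈ vectorSpan ℝ P :=
    fun x hx => vsub_mem_vectorSpan ℝ (hτ x hx) (hτ c hc)
  exact ⟨euclideanHausdorffMeasure_convexHull_ne_zero _ hsub hi hcard,
    euclideanHausdorffMeasure_convexHull_ne_top _ (sub_mem_of_mem_convexHull hsub)⟩

/-- A polytope given by inequalities that take only the values `0` and `1` at its lattice points
is compressed. -/
theorem isCompressed_of_zero_one {Λ : Submodule ℤ (EuclideanSpace ℝ (Fin d))}
    {P : Set (EuclideanSpace ℝ (Fin d))} (hP : IsLatticePolytope Λ P) (hne : P.Nonempty)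
    {T : Set (EuclideanSpace ℝ (Fin d) →ᵃ[ℝ] ℝ)} (hT : T.Finite)
    (hdesc : P = {x | ∀ h ∈ T, 0 ≤ h x})
    (hlevel : ∀ h ∈ T, ∀ x ∈ P ∩ Λ, h x = 0 ∨ h x = 1) : IsCompressed Λ P := by
  classical
  intro l _ hl σ hσ
  have hlP : P = convexHull ℝ {x | x ∈ l} := by
    have : {x | x ∈ l} = P ∩ Λ := Set.ext hl
    rw [this]
    exact hP.eq_convexHull
  obtain ⟨h1, h2, h3⟩ := hσ.affineIndependent_and_card hlP hne
  have hσP : (σ : Set (EuclideanSpace ℝ (Fin d))) ⊆ P ∩ Λ := fun x hx => (hl x).1 (h1 x hx)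
  refine ⟨⟨σ, ⟨hσP, h2, h3⟩, rfl⟩, ?_⟩
  rintro _ ⟨τ, ⟨hτP, hτi, hτc⟩, rfl⟩
  refine euclideanHausdorffMeasure_le_of_int_weights _
    (fun x hx y hy => vsub_mem_vectorSpan ℝ (hσP hx).1 (hσP hy).1) h2 h3
    (fun x hx y hy => vsub_mem_vectorSpan ℝ (hτP hx).1 (hτP hy).1) hτi hτc fun x hx => ?_
  refine hσ.exists_int_weights hlP hT hdesc (fun h hh y hy => hlevel h hh y ((hl y).1 hy))
    (mem_affineSpan ℝ (hτP hx).1) fun h hh => ?_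
  rcases hlevel h hh x (hτP hx) with h0 | h0
  · exact ⟨0, by simp [h0]⟩
  · exact ⟨1, by simp [h0]⟩

/-- All lattice points of a compressed polytope off a facet have the same height over it. -/
theorem IsCompressed.eq_of_isFacet {Λ : Submodule ℤ (EuclideanSpace ℝ (Fin d))}
    [DiscreteTopology Λ] {P : Set (EuclideanSpace ℝ (Fin d))} (hcomp : IsCompressed Λ P)
    (hP : IsLatticePolytope Λ P)
    {T : Set (EuclideanSpace ℝ (Fin d) →ᵃ[ℝ] ℝ)} (hT : T.Finite)
    (hdesc : P = {x | ∀ h ∈ T, 0 ≤ h x}) {h : EuclideanSpace ℝ (Fin d) →ᵃ[ℝ] ℝ} (hh : h ∈ T)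
    (hF : IsFacet P (P ∩ {x | h x = 0})) {p q : EuclideanSpace ℝ (Fin d)} (hp : p ∈ P ∩ Λ)
    (hq : q ∈ P ∩ Λ) (hhp : 0 < h p) (hhq : 0 < h q) : h p = h q := by
  classical
  by_contra hpq
  have hne : p ≠ q := fun h => hpq (by rw [h])
  have hfin : (P ∩ Λ).Finite := finite_inter_of_isBounded hP.isBounded
  set R := ((hfin.toFinset.erase p).erase q).toList with hR
  set F := P ∩ {x | h x = 0} with hFdef
  have hmemR : ∀ x, x ∈ R ↔ x ≠ q ∧ x ≠ p ∧ x ∈ P ∩ Λ := by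
    intro x
    rw [hR, Finset.mem_toList, Finset.mem_erase, Finset.mem_erase, Set.Finite.mem_toFinset]
  have hRnd : R.Nodup := Finset.nodup_toList _
  have hmem : ∀ x, x ∈ p :: q :: R ↔ x ∈ P ∩ Λ := by
    intro x
    rw [List.mem_cons, List.mem_cons, hmemR]
    by_cases h1 : x = p
    · simp [h1, hp]
    by_cases h2 : x = q
    · simp [h2, hq]
    simp [h1, h2]
  have hmem' : ∀ x, x ∈ q :: p :: R ↔ x ∈ P ∩ Λ := by
    intro x
    rw [← hmem x, List.mem_cons, List.mem_cons, List.mem_cons, List.mem_cons]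
    tauto
  have hhull : ∀ l : List (EuclideanSpace ℝ (Fin d)), (∀ x, x ∈ l ↔ x ∈ P ∩ Λ) →
      P = convexHull ℝ {x | x ∈ l} := by
    intro l hl
    rw [show {x | x ∈ l} = P ∩ Λ from Set.ext hl]
    exact hP.eq_convexHull
  have hpF : p ∉ F := fun hmem => hhp.ne' hmem.2
  have hqF : q ∉ F := fun hmem => hhq.ne' hmem.2
  obtain ⟨τ, σ, σ', hτF, hστ, hστ', hσp, hσq⟩ := hF.exists_isPullingSimplex_insert
    (hT.insert (-h)) (forall_nonneg_insert_neg hdesc hh) hne hpF hqF (hhull _ hmem)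
  have hnd : (p :: q :: R).Nodup := by
    simp [hRnd, hmemR, hne]
  have hnd' : (q :: p :: R).Nodup := by
    simp [hRnd, hmemR, hne.symm]
  have heq := (hcomp _ hnd hmem _ hσp).unique (hcomp _ hnd' hmem' _ hσq)
  obtain ⟨h1, h2, h3⟩ := hσp.affineIndependent_and_card (hhull _ hmem) ⟨p, hp.1⟩
  obtain ⟨h0, htop⟩ := simplexVolume_ne_zero_and_ne_top (fun x hx => ((hmem x).1 (h1 x hx)).1) h2 h3
  have hvol := euclideanHausdorffMeasure_convexHull_insert (vectorSpan ℝ P)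
    (τ := τ) (h := h) (fun x hx => (hτF hx).2) hhp hhq
    (fun x hx => vsub_mem_vectorSpan ℝ (hτF hx).1 hp.1) (vsub_mem_vectorSpan ℝ hq.1 hp.1)
  rw [← hστ, ← hστ'] at hvol
  have hvol' : simplexVolume P σ' = ENNReal.ofReal (h q / h p) * simplexVolume P σ := hvol
  rw [← heq] at hvol'
  have h4 : ENNReal.ofReal (h q / h p) = 1 := by
    have := hvol'.symm
    rwa [ENNReal.mul_eq_right h0 htop] at this
  rw [ENNReal.ofReal_eq_one, div_eq_one_iff_eq hhp.ne'] at h4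
  exact hpq h4.symm

/-- A polytope given by `n` inequalities that take only the values `0` and `1` at its lattice
points is lattice isomorphic to a section of the `n`-dimensional cube. -/
theorem isLatticeIsomorphicToCubeSection_of_zero_one {n : ℕ}
    {Λ : Submodule ℤ (EuclideanSpace ℝ (Fin d))} {P : Set (EuclideanSpace ℝ (Fin d))}
    (hP : IsLatticePolytope Λ P) (hne : P.Nonempty)
    {g : Fin n → EuclideanSpace ℝ (Fin d) →ᵃ[ℝ] ℝ} (hdesc : P = {x | ∀ i, 0 ≤ g i x})
    (hlevel : ∀ i, ∀ x ∈ P ∩ Λ, g i x = 0 ∨ g i x = 1) :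
    IsLatticeIsomorphicToCubeSection Λ P n := by
  let f : EuclideanSpace ℝ (Fin d) →ᵃ[ℝ] EuclideanSpace ℝ (Fin n) :=
    (WithLp.linearEquiv 2 ℝ (Fin n → ℝ)).symm.toLinearMap.toAffineMap.comp (AffineMap.pi g)
  have hf : ∀ x i, f x i = g i x := fun x i => rfl
  have hinj : Function.Injective f := by
    intro x y hxy
    obtain ⟨p, hp⟩ := hne
    refine sub_eq_zero.1 (eq_zero_of_ray_subset hP.isBounded (p := p) (v := x - y) fun t _ => ?_)
    rw [hdesc] at hp ⊢
    intro i
    have : g i x = g i y := by rw [← hf, ← hf, hxy]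
    rw [AffineMap.apply_add_smul, AffineMap.linear_sub_apply, this, sub_self, mul_zero, add_zero]
    exact hp i
  have hnonneg : ∀ x ∈ P, ∀ i, 0 ≤ g i x := fun x hx => by rw [hdesc] at hx; exact hx
  have hle : ∀ x ∈ P, ∀ i, g i x ≤ 1 := by
    intro x hx i
    rw [hP.eq_convexHull] at hx
    refine convexHull_min (t := {x | g i x ≤ 1}) (fun y hy => ?_) ?_ hx
    · rcases hlevel i y hy with h | h <;> simp [h]
    · intro u hu v hv s t hs ht hst
      simp only [Set.mem_ofPred_eq] at hu hv ⊢
      rw [AffineMap.apply_convexComb _ _ _ hst]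
      nlinarith
  have himg : f '' P = unitCube n ∩ ((⊤ : AffineSubspace ℝ _).map f : AffineSubspace ℝ _) := by
    ext y
    constructor
    · rintro ⟨x, hx, rfl⟩
      exact ⟨fun i => ⟨hnonneg x hx i, hle x hx i⟩, AffineSubspace.mem_map_of_mem f trivial⟩
    · rintro ⟨hy, hyL⟩
      obtain ⟨x, -, rfl⟩ := (AffineSubspace.mem_map).1 hyL
      refine ⟨x, ?_, rfl⟩
      rw [hdesc]
      exact fun i => (hy i).1
  have hlat : ∀ x ∈ P ∩ Λ, f x ∈ integerLattice n := by
    intro x hx i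
    rcases hlevel i x hx with h | h
    · exact ⟨0, by rw [hf, h]; simp⟩
    · exact ⟨1, by rw [hf, h]; simp⟩
  refine ⟨(⊤ : AffineSubspace ℝ _).map f, ?_, f, ?_, ?_⟩
  · classical
    obtain ⟨s, hs, hsP⟩ := hP
    refine ⟨s.image f, ?_, ?_⟩
    · intro y hy
      rw [Finset.coe_image] at hy
      obtain ⟨x, hx, rfl⟩ := hy
      exact hlat x ⟨hsP ▸ subset_convexHull ℝ _ hx, hs hx⟩
    · rw [← himg, Finset.coe_image, ← AffineMap.image_convexHull, ← hsP]
  · rw [← himg]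
    exact hinj.injOn.bijOn_image
  · rw [← himg]
    refine ⟨fun x hx => ⟨⟨x, hx.1, rfl⟩, hlat x hx⟩, hinj.injOn, ?_⟩
    rintro _ ⟨⟨x, hx, rfl⟩, hint⟩
    refine ⟨x, ⟨hx, ?_⟩, rfl⟩
    have h01 : ∀ i, g i x = 0 ∨ g i x = 1 := by
      intro i
      obtain ⟨k, hk⟩ := hint i
      rw [hf] at hk
      have h1 := hnonneg x hx i
      have h2 := hle x hx i
      rw [hk] at h1 h2 ⊢
      norm_cast at h1 h2 ⊢
      omega
    have hext : x ∈ P.extremePoints ℝ := by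
      refine ⟨hx, fun y hy z hz hxyz => ?_⟩
      obtain ⟨s, t, hs, ht, hst, rfl⟩ := hxyz
      apply hinj
      ext i
      have h1 := h01 i
      have h2 := hnonneg y hy i
      have h3 := hnonneg z hz i
      have h4 := hle y hy i
      have h5 := hle z hz i
      rw [hf, hf]
      rw [AffineMap.apply_convexComb _ _ _ hst] at h1 ⊢
      obtain rfl : t = 1 - s := by linarith
      rcases h1 with h1 | h1
      · have := mul_nonneg hs.le h2
        have := mul_nonneg ht.le h3
        have h6 : s * g i y = 0 := by linarith
        have := (mul_eq_zero.1 h6).resolve_left hs.ne'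
        linarith
      · have := mul_nonneg hs.le (sub_nonneg.2 h4)
        have := mul_nonneg ht.le (sub_nonneg.2 h5)
        have h6 : s * (1 - g i y) = 0 := by linarith
        have := (mul_eq_zero.1 h6).resolve_left hs.ne'
        linarith
    obtain ⟨s, hs, rfl⟩ := hP
    exact hs (extremePoints_convexHull_subset hext)

/-- If a polytope is lattice isomorphic to a section of a cube, then all its lattice points off a
facet have the same height over it. -/
theorem IsLatticeIsomorphicToCubeSection.eq_of_tight {N : ℕ}
    {Λ : Submodule ℤ (EuclideanSpace ℝ (Fin d))} {P : Set (EuclideanSpace ℝ (Fin d))}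
    (hcube : IsLatticeIsomorphicToCubeSection Λ P N)
    {T : Set (EuclideanSpace ℝ (Fin d) →ᵃ[ℝ] ℝ)} (hT : T.Finite)
    (hdesc : P = {x | ∀ h ∈ T, 0 ≤ h x}) {h : EuclideanSpace ℝ (Fin d) →ᵃ[ℝ] ℝ} (hh : h ∈ T)
    {w : EuclideanSpace ℝ (Fin d)} (hw : w ∈ P) (hwh : h w = 0)
    (htight : ∀ g ∈ T, g ≠ h → g w = 0 → ∀ y ∈ P, g y = 0)
    {p q : EuclideanSpace ℝ (Fin d)} (hp : p ∈ P ∩ Λ)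
    (hq : q ∈ P ∩ Λ) (hhp : 0 < h p) (hhq : 0 < h q) : h p = h q := by
  obtain ⟨L, -, f, hfP, hfΛ⟩ := hcube
  have hconv : Convex ℝ P := hdesc ▸ convex_forall_nonneg T
  let c : Fin N → EuclideanSpace ℝ (Fin d) →ᵃ[ℝ] ℝ := fun j =>
    (EuclideanSpace.proj (𝕜 := ℝ) j : EuclideanSpace ℝ (Fin N) →ₗ[ℝ] ℝ).toAffineMap.comp f
  have hc : ∀ j x, c j x = f x j := fun j x => rfl
  let S : Set (EuclideanSpace ℝ (Fin d) →ᵃ[ℝ] ℝ) :=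
    Set.range c ∪ Set.range fun j => AffineMap.const ℝ _ 1 - c j
  have hS : S.Finite := (Set.finite_range _).union (Set.finite_range _)
  have hScube : ∀ x, (∀ g ∈ S, 0 ≤ g x) ↔ f x ∈ unitCube N := by
    intro x
    constructor
    · intro hx j
      refine ⟨hx (c j) (Or.inl ⟨j, rfl⟩), ?_⟩
      have := hx _ (Or.inr ⟨j, rfl⟩)
      simpa [hc] using this
    · rintro hx _ (⟨j, rfl⟩ | ⟨j, rfl⟩)
      · exact (hx j).1
      · simpa [hc] using (hx j).2
  have hSP : ∀ x ∈ P, ∀ g ∈ S, 0 ≤ g x := fun x hx => (hScube x).2 (hfP.mapsTo hx).1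
  have hSΛ : ∀ x ∈ P ∩ Λ, ∀ g ∈ S, g x = 0 ∨ g x = 1 := by
    intro x hx
    have hcx : ∀ j, c j x = 0 ∨ c j x = 1 := by
      intro j
      obtain ⟨k, hk⟩ := (hfΛ.mapsTo hx).2 j
      have h1 : 0 ≤ c j x := ((hfP.mapsTo hx.1).1 j).1
      have h2 : c j x ≤ 1 := ((hfP.mapsTo hx.1).1 j).2
      rw [← hc] at hk
      rw [hk] at h1 h2 ⊢
      norm_cast at h1 h2 ⊢
      omega
    rintro _ (⟨j, rfl⟩ | ⟨j, rfl⟩)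
    · exact hcx j
    · rcases hcx j with h | h <;> simp [h]
  obtain ⟨g, hg, hgw, x, hx, hgx⟩ : ∃ g ∈ S, g w = 0 ∧ ∃ x ∈ P, g x ≠ 0 := by
    by_contra! hcon
    obtain ⟨ε, hε, hmem⟩ := exists_pos_add_smul_nonneg (x := w) (v := w - p) hS (hSP w hw)
      (fun g hg h0 => by rw [AffineMap.linear_sub_apply, h0, hcon g hg h0 p hp.1, sub_zero])
    have hfy : f (w + ε • (w - p)) = ε • (f w - f p) + f w := by
      have := f.map_vadd w (ε • (w - p))
      rw [vadd_eq_add, vadd_eq_add, map_smul, ← vsub_eq_sub, AffineMap.linearMap_vsub,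
        vsub_eq_sub, vsub_eq_sub] at this
      rw [add_comm, this]
    have hyL : f (w + ε • (w - p)) ∈ L := by
      rw [hfy]
      exact AffineSubspace.vadd_mem_of_mem_direction (Submodule.smul_mem _ _
        (AffineSubspace.vsub_mem_direction (hfP.mapsTo hw).2 (hfP.mapsTo hp.1).2))
        (hfP.mapsTo hw).2
    obtain ⟨y, hy, hyeq⟩ := hfP.surjOn ⟨(hScube _).1 hmem, hyL⟩
    have hsum : (1 / (1 + ε)) + (ε / (1 + ε)) = 1 := by field_simp
    have hw' : (1 / (1 + ε)) • y + (ε / (1 + ε)) • p ∈ P :=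
      hconv hy hp.1 (by positivity) (by positivity) hsum
    have hfw' : f ((1 / (1 + ε)) • y + (ε / (1 + ε)) • p) = f w := by
      rw [Convex.combo_affine_apply hsum, hyeq, hfy]
      match_scalars <;> field_simp <;> ring
    have hww := hfP.injOn hw' hw hfw'
    have hhy : 0 ≤ h y := by rw [hdesc] at hy; exact hy h hh
    have h1 := congrArg h hww
    rw [AffineMap.apply_convexComb _ _ _ hsum, hwh] at h1
    have h2 : 0 < ε / (1 + ε) * h p := by positivity
    have h3 : 0 ≤ 1 / (1 + ε) * h y := by positivity
    linarith
  have hlin : ∀ v ∈ vectorSpan ℝ P, h.linear v = 0 → 0 ≤ g.linear v := by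
    intro v hv hv0
    obtain ⟨ε, hε, hmem⟩ := exists_pos_add_smul_mem_of_tight hT hdesc hw htight hv hv0
    have h1 := hSP _ hmem g hg
    rw [AffineMap.apply_add_smul, hgw, zero_add] at h1
    exact nonneg_of_mul_nonneg_right h1 hε
  have hprop : ∀ y ∈ P, ∀ z ∈ P, h z * g y = h y * g z := by
    intro y hy z hz
    have hv : h z • (y - w) - h y • (z - w) ∈ vectorSpan ℝ P :=
      sub_mem (Submodule.smul_mem _ _ (vsub_mem_vectorSpan ℝ hy hw))
        (Submodule.smul_mem _ _ (vsub_mem_vectorSpan ℝ hz hw))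
    have hv0 : h.linear (h z • (y - w) - h y • (z - w)) = 0 := by
      simp only [map_sub, map_smul, smul_eq_mul]
      rw [← map_sub, ← map_sub, AffineMap.linear_sub_apply, AffineMap.linear_sub_apply, hwh]
      ring
    have hgv : g.linear (h z • (y - w) - h y • (z - w)) = h z * g y - h y * g z := by
      rw [map_sub, map_smul, map_smul, AffineMap.linear_sub_apply, AffineMap.linear_sub_apply, hgw]
      simp
    have h1 := hlin _ hv hv0
    have h2 := hlin _ (neg_mem hv) (by rw [map_neg, hv0, neg_zero])
    rw [map_neg] at h2
    linarith
  have hg1 : ∀ y ∈ P ∩ Λ, 0 < h y → g y = 1 := by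
    intro y hy hhy
    refine (hSΛ y hy g hg).resolve_left fun h0 => hgx ?_
    have := hprop y hy.1 x hx
    rw [h0, mul_zero] at this
    exact (mul_eq_zero.1 this.symm).resolve_left hhy.ne'
  have := hprop p hp.1 q hq.1
  rw [hg1 p hp hhp, hg1 q hq hhq] at this
  linarith

end Compressed

theorem theorem2p4 {d n : ℕ} (Λ : Submodule ℤ (EuclideanSpace ℝ (Fin d))) [DiscreteTopology Λ]
    (P : Set (EuclideanSpace ℝ (Fin d))) (hP : IsLatticePolytope Λ P) (hne : P.Nonempty)
    (a : Fin n → EuclideanSpace ℝ (Fin d)) (b : Fin n → ℝ)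
    (hdesc : P = {x | ∀ i, b i ≤ inner ℝ (a i) x})
    (hirr : ∀ i, {x | ∀ j, j ≠ i → b j ≤ inner ℝ (a j) x} ≠ P) :
    List.TFAE
      [IsCompressed Λ P,
        ∀ i, {m : ℝ | m ≠ 0 ∧
          ({x | x ∈ Λ ∧ inner ℝ (a i) x = b i + m} ∩ P).Nonempty}.Subsingleton,
        ∃ N : ℕ, IsLatticeIsomorphicToCubeSection Λ P N,
        IsLatticeIsomorphicToCubeSection Λ P n] := by
  let h : Fin n → EuclideanSpace ℝ (Fin d) →ᵃ[ℝ] ℝ := fun i =>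
    (innerₛₗ ℝ (a i)).toAffineMap - AffineMap.const ℝ _ (b i)
  have hh : ∀ i x, h i x = inner ℝ (a i) x - b i := fun i x => by simp [h]
  have hdesc' : P = {x | ∀ g ∈ Set.range h, 0 ≤ g x} := by
    rw [hdesc]; ext x; simp [hh]
  have hT : (Set.range h).Finite := Set.finite_range h
  have hpos : ∀ x ∈ P, ∀ i, 0 ≤ h i x := fun x hx i => by
    rw [hdesc'] at hx; exact hx _ ⟨i, rfl⟩
  have htight : ∀ i, ∀ x ∈ P, 0 < h i x → ∃ w ∈ P, h i w = 0 ∧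
      ∀ g ∈ Set.range h, g ≠ h i → g w = 0 → ∀ y ∈ P, g y = 0 := by
    intro i x hx hxi
    obtain ⟨z, hz, hzi⟩ : ∃ z, (∀ j, j ≠ i → 0 ≤ h j z) ∧ h i z < 0 := by
      by_contra! hcon
      refine hirr i (Set.Subset.antisymm (fun z hz => ?_) fun z hz j _ => ?_)
      · have h1 : ∀ j, j ≠ i → 0 ≤ h j z := fun j hj => by
          rw [hh, sub_nonneg]; exact hz j hj
        rw [hdesc']
        rintro _ ⟨j, rfl⟩
        by_cases hj : j = i
        · rw [hj]; exact hcon z h1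
        · exact h1 j hj
      · rw [hdesc] at hz; exact hz j
    refine exists_tight_of_irredundant hT hdesc' ⟨i, rfl⟩ (z := z) ?_ hzi hx hxi
    rintro _ ⟨j, rfl⟩ hj
    exact hz j fun hji => hj (by rw [hji])
  have htwo : (∀ i, ∀ p ∈ P ∩ Λ, ∀ q ∈ P ∩ Λ, 0 < h i p → 0 < h i q → h i p = h i q) →
      ∀ i, {m : ℝ | m ≠ 0 ∧
        ({x | x ∈ Λ ∧ inner ℝ (a i) x = b i + m} ∩ P).Nonempty}.Subsingleton := by
    rintro H i m ⟨hm, p, ⟨hpΛ, hpm⟩, hpP⟩ m' ⟨hm', q, ⟨hqΛ, hqm⟩, hqP⟩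
    have h1 : h i p = m := by rw [hh, hpm]; ring
    have h2 : h i q = m' := by rw [hh, hqm]; ring
    rw [← h1] at hm ⊢
    rw [← h2] at hm' ⊢
    exact H i p ⟨hpP, hpΛ⟩ q ⟨hqP, hqΛ⟩ ((hpos p hpP i).lt_of_ne hm.symm)
      ((hpos q hqP i).lt_of_ne hm'.symm)
  have hscale : (∀ i, {m : ℝ | m ≠ 0 ∧
        ({x | x ∈ Λ ∧ inner ℝ (a i) x = b i + m} ∩ P).Nonempty}.Subsingleton) →
      ∃ g : Fin n → EuclideanSpace ℝ (Fin d) →ᵃ[ℝ] ℝ, P = {x | ∀ i, 0 ≤ g i x} ∧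
        ∀ i, ∀ x ∈ P ∩ Λ, g i x = 0 ∨ g i x = 1 := by
    intro H
    have : ∀ i, ∃ c : ℝ, 0 < c ∧ ∀ x ∈ P ∩ Λ, c * h i x = 0 ∨ c * h i x = 1 := by
      intro i
      by_cases hp : ∃ p ∈ P ∩ Λ, h i p ≠ 0
      · obtain ⟨p, hp, hp0⟩ := hp
        refine ⟨(h i p)⁻¹, inv_pos.2 ((hpos p hp.1 i).lt_of_ne hp0.symm), fun x hx => ?_⟩
        by_cases hx0 : h i x = 0
        · left; rw [hx0, mul_zero]
        · right
          have := H i ⟨hx0, x, ⟨hx.2, by rw [hh]; ring⟩, hx.1⟩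
            ⟨hp0, p, ⟨hp.2, by rw [hh]; ring⟩, hp.1⟩
          rw [this, inv_mul_cancel₀ hp0]
      · push Not at hp
        exact ⟨1, one_pos, fun x hx => by left; rw [hp x hx, mul_zero]⟩
    choose c hc0 hc using this
    refine ⟨fun i => c i • h i, ?_, fun i x hx => by simpa using hc i x hx⟩
    rw [hdesc']
    ext x
    simp [mul_nonneg_iff_of_pos_left, hc0]
  tfae_have 1 → 2 := fun hcomp => htwo fun i p hp q hq hip hiq => by
    obtain ⟨w, hw, hwi, hwT⟩ := htight i p hp.1 hip
    exact hcomp.eq_of_isFacet hP hT hdesc' ⟨i, rfl⟩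
      (isFacet_of_tight hT hdesc' ⟨i, rfl⟩ hp.1 hip hw hwi hwT) hp hq hip hiq
  tfae_have 2 → 1 := fun H => by
    obtain ⟨g, hg, hlevel⟩ := hscale H
    refine isCompressed_of_zero_one hP hne (Set.finite_range g) (hg.trans ?_) ?_
    · ext x; simp
    · rintro _ ⟨i, rfl⟩; exact hlevel i
  tfae_have 2 → 4 := fun H => by
    obtain ⟨g, hg, hlevel⟩ := hscale H
    exact isLatticeIsomorphicToCubeSection_of_zero_one hP hne hg hlevel
  tfae_have 4 → 3 := fun H => ⟨n, H⟩
  tfae_have 3 → 2 := fun ⟨N, hN⟩ => htwo fun i p hp q hq hip hiq => by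
    obtain ⟨w, hw, hwi, hwT⟩ := htight i p hp.1 hip
    exact hN.eq_of_tight hT hdesc' ⟨i, rfl⟩ hw hwi hwT hp hq hip hiq
  tfae_finish
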